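/- Let $N\ge 2$, let $q\in\mathbb C^\times$ be not a root of unity, fix a value of $\log q$, and put $q^\alpha=\exp(\alpha\log q)$ for $\alpha\in\mathbb C$. Let $\boldsymbol\lambda=(\lambda_1,\dots,\lambda_N)\in\mathbb C^N$ be generic, that is, $q^{2(\lambda_i-\lambda_j)}\ne q^{2s}$ for all $i<j$ and $s\in\mathbb Z$. Let $T_1,\dots,T_{N-1}\in\mathbb C[x]$ be monic, let $\boldsymbol l=(l_1,\dots,l_{N-1})\in\mathbb Z_{\ge0}^{N-1}$, $l_0=l_N=0$, and let $\boldsymbol t=(t^{(i)}_j)_{1\le i\le N-1,\,1\le j\le l_i}\in\mathbb C^{\boldsymbol l}=\mathbb C^{l_1}\oplus\dots\oplus\mathbb C^{l_{N-1}}$. The group $S_{\boldsymbol l}=S_{l_1}\times\dots\times S_{l_{N-1}}$ acts on $\mathbb C^{\boldsymbol l}$ by permuting coordinates with the same superscript. **Bethe ansatz equations.** $\boldsymbol t$ is a solution if for all $1\le i\le N-1$, $1\le j\le l_i$, $$T_i(t_j^{(i)}q^2)\prod_{r=1}^{l_{i-1}}(t_j^{(i)}q-t_r^{(i-1)}q^{-1})\prod_{s=1}^{l_{i+1}}(t_j^{(i)}-t_s^{(i+1)})\prod_{k\ne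 j}(t_j^{(i)}q^{-1}-t_k^{(i)}q)$$ $$=q^{2(\lambda_{i+1}-\lambda_i+l_i)-l_{i-1}-l_{i+1}}\,T_i(t_j^{(i)})\prod_{r=1}^{l_{i-1}}(t_j^{(i)}-t_r^{(i-1)})\prod_{s=1}^{l_{i+1}}(t_j^{(i)}q^{-1}-t_s^{(i+1)}q)\prod_{k\ne j}(t_j^{(i)}q-t_k^{(i)}q^{-1}).$$ Put $p_i(x)=\prod_{j=1}^{l_i}(x-t^{(i)}_j)$, $p_0=p_N=1$, and $$P_i(x)=q^{2\lambda_{i+1}}p_i(xq^2)p_{i-1}(x)p_{i+1}(xq^{-2})T_i(x)+q^{2\lambda_i}p_i(xq^{-2})p_{i-1}(xq^2)p_{i+1}(x)T_i(xq^2).$$ The solution $\boldsymbol t$ is regular if, whenever $I\subset\{1,\dots,l_i\}$ and all $t^{(i)}_j$, $j\in I$, are equal to the same number $a$, one has $P_i^{(k)}(a)=0$ for $k=0,\dots,|I|-1$. The point $\boldsymbol t$ is admissible if $t^{(i)}_j\ne t^{(i)}_kq^2$ for all $i$ and all $j,k$ (including $j=k$). **Quasi-polynomials.** A quasi-polynomial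 of type $\alpha\in\mathbb C$ is an expression $f(x)=x^\alpha p(x,\log x)$ with $p(x,s)$ a polynomial; it is log-free if $p$ does not depend on $s$; a polynomial $r(x)$ divides $f$ if $r(x)$ divides $p(x,s)$. Moreover $f(xq^\beta)=q^{\alpha\beta}x^\alpha p(xq^\beta,\log x+\beta\log q)$. Let $W_k[g_1,\dots,g_k](x)=\det\bigl(g_i(xq^{-2(j-1)})\bigr)_{i,j=1}^k$. A collection of quasi-polynomials of type $\boldsymbol\lambda$ is $U=(u_1,\dots,u_N)$ with $u_i$ a quasi-polynomial of type $\lambda_i$ and $W_N[u_1,\dots,u_N]\ne0$. It is semiregular if $W_N[u_1,\dots,u_N]$ is log-free. For monic polynomials $\boldsymbol T=(T_1,\dots,T_N)$ put $Q_k(x)=\prod_{i=1}^k\prod_{j=0}^{k-i}T_{N-i+1}(xq^{-2j})$. $\boldsymbol T$ is a preframe of a semiregular $U$ if for every $1\le k\le N-1$ and every $\{i_1<\dots<i_k\}\subset\{1,\dots,N\}$ the polynomial $Q_k$ divides the quasi-polynomial $W_k[u_{i_1},\dots,u_{i_k}]$ of type $\lambda_{i_1}+\dots+\lambda_{i_k}$,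 and $W_N[u_1,\dots,u_N]=\mathrm{const}\cdot x^{\lambda_1+\dots+\lambda_N}Q_N(x)$. Then define $y_i$ by $W_{N-i}[u_{i+1},\dots,u_N]=y_i\,Q_{N-i}$ for $1\le i\le N-1$; $U$ is regular if $y_1,\dots,y_{N-1}$ are log-free. In that case $y_i(x)=c_i\,x^{\lambda_{i+1}+\dots+\lambda_N}\prod_{j=1}^{m_i}(x-s^{(i)}_j)$ with $c_i\ne0$, and $X_{U,\boldsymbol T}$ denotes the orbit of $(s^{(i)}_j)\in\mathbb C^{\boldsymbol m}$ under $S_{\boldsymbol m}$, $\boldsymbol m=(m_1,\dots,m_{N-1})$. **Difference operators.** Let $(\tau f)(x)=f(xq^{-2})$. Let $D_U$ be the unique monic difference operator $a_0+a_1\tau+\dots+a_{N-1}\tau^{N-1}+\tau^N$ with $D_Uu_i=0$ for all $i$, i.e. $D_Uf=W_{N+1}[u_1,\dots,u_N,f]/W_N[u_1,\dots,u_N]$. Let $$R_i(x)=\frac{p_{i-1}(x)}{p_i(x)}\prod_{j=i}^{N-1}T_j(xq^{2(i-j)}),\qquad D^{\boldsymbol t}=\Bigl(\tau-q^{-2\lambda_1}\frac{R_1(xq^{-2})}{R_1(x)}\Bigr)\cdots\Bigl(\tau-q^{-2\lambda_N}\frac{R_N(xq^{-2})}{R_N(x)}\Bigr).$$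 **Theorem.** Let $\boldsymbol t$ be an admissible regular solution of the Bethe ansatz equations, and let $U$ be a collection of quasi-polynomials of type $\boldsymbol\lambda$ such that $D^{\boldsymbol t}=D_U$. Then $\boldsymbol T=(T_1,\dots,T_{N-1},1)$ is a preframe of $U$, the collection $U$ is regular, and the $S_{\boldsymbol l}$-orbit of $\boldsymbol t$ equals $X_{U,\boldsymbol T}$. -/

import Mathlib

open Polynomial

noncomputable section

namespace XXZ

/-! ### Quasi-polynomials and functions of `x`

Functions of `x` are treated algebraically. `QuasiRing` is the ring of all finite sums of terms
`c * x ^ α * (log x) ^ k` (with `c α : ℂ`, `k : ℕ`): the group algebra of `ℂ` accounts for the powers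
`x ^ α` (so `x ^ α * x ^ β = x ^ (α + β)`), and the polynomial variable is `log x`. It is a domain,
and `QuasiField` is its field of fractions. -/

/-- Finite sums of terms `c * x ^ α * (log x) ^ k`. -/
abbrev QuasiRing : Type := Polynomial (AddMonoidAlgebra ℂ ℂ)

/-- Quotients of elements of `QuasiRing`. -/
abbrev QuasiField : Type := FractionRing QuasiRing

/-- The characters `α ↦ e ^ (α * c) * x ^ α`. -/
def powHom (c : ℂ) : Multiplicative ℂ →* AddMonoidAlgebra ℂ ℂ where
  toFun α := AddMonoidAlgebra.single α.toAdd (Complex.exp (α.toAdd * c))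
  map_one' := by simp [AddMonoidAlgebra.one_def]
  map_mul' α β := by
    simp [AddMonoidAlgebra.single_mul_single, add_mul, Complex.exp_add]

/-- The substitution `f(x) ↦ f(x * e ^ c)`, that is `x ^ α ↦ e ^ (α * c) * x ^ α` and
`log x ↦ log x + c`. -/
def shiftHom (c : ℂ) : QuasiRing →+* QuasiRing :=
  Polynomial.eval₂RingHom
    ((Polynomial.C : AddMonoidAlgebra ℂ ℂ →+* QuasiRing).comp
      (AddMonoidAlgebra.lift ℂ (AddMonoidAlgebra ℂ ℂ) ℂ (powHom c)).toRingHom)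
    (Polynomial.X + Polynomial.C (algebraMap ℂ (AddMonoidAlgebra ℂ ℂ) c))

theorem shiftHom_single (c α b : ℂ) :
    shiftHom c (Polynomial.C (AddMonoidAlgebra.single α b)) =
      Polynomial.C (AddMonoidAlgebra.single α (b * Complex.exp (α * c))) := by
  simp [shiftHom, powHom, AddMonoidAlgebra.lift_single]

theorem shiftHom_X (c : ℂ) :
    shiftHom c Polynomial.X =
      Polynomial.X + Polynomial.C (AddMonoidAlgebra.single 0 c) := by
  simp [shiftHom]

theorem shiftHom_comp (c d : ℂ) :
    (shiftHom c).comp (shiftHom d) = shiftHom (c + d) := by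
  refine Polynomial.ringHom_ext' (AddMonoidAlgebra.ringHom_ext ?_ ?_) ?_
  · intro b
    simp [shiftHom_single]
  · intro α
    simp [shiftHom_single, ← Complex.exp_add, mul_add, add_comm]
  · simp only [RingHom.comp_apply, shiftHom_X, map_add, shiftHom_single, zero_mul,
      Complex.exp_zero, mul_one]
    rw [add_assoc, ← map_add Polynomial.C, ← AddMonoidAlgebra.single_add]

theorem shiftHom_zero : shiftHom 0 = RingHom.id QuasiRing := by
  refine Polynomial.ringHom_ext' (AddMonoidAlgebra.ringHom_ext ?_ ?_) ?_
  · intro b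
    simp [shiftHom_single]
  · intro α
    simp [shiftHom_single]
  · simp [shiftHom_X]

/-- The substitution `f(x) ↦ f(x * e ^ c)` as an automorphism of `QuasiRing`. -/
def shiftEquiv (c : ℂ) : QuasiRing ≃+* QuasiRing :=
  RingEquiv.ofRingHom (shiftHom c) (shiftHom (-c))
    (by rw [shiftHom_comp, add_neg_cancel, shiftHom_zero])
    (by rw [shiftHom_comp, neg_add_cancel, shiftHom_zero])

/-- The substitution `f(x) ↦ f(x * e ^ c)` on `QuasiField`. -/
def shift (c : ℂ) : QuasiField ≃+* QuasiField :=
  IsFractionRing.ringEquivOfRingEquiv (shiftEquiv c)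

theorem shift_algebraMap (c : ℂ) (f : QuasiRing) :
    shift c (algebraMap QuasiRing QuasiField f) =
      algebraMap QuasiRing QuasiField (shiftHom c f) := by
  simp [shift, shiftEquiv]

/-- The function `x ^ α`. -/
def xpow (α : ℂ) : QuasiField :=
  algebraMap QuasiRing QuasiField (Polynomial.C (AddMonoidAlgebra.single α 1))

/-- The function `p(x, log x)`, for a polynomial `p(x, s)` in `s` with coefficients in `ℂ[x]`. -/
def evalLog : ℂ[X][X] →+* QuasiField :=
  (algebraMap QuasiRing QuasiField).comp
    (Polynomial.mapRingHom
      (Polynomial.aeval (AddMonoidAlgebra.single (1 : ℂ) (1 : ℂ))).toRingHom)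

/-- The function `r(x)`, for a polynomial `r`. -/
def ofPoly : ℂ[X] →+* QuasiField := evalLog.comp Polynomial.C

/-- `f` is a quasi-polynomial of type `α`: `f(x) = x ^ α * p(x, log x)`. -/
def IsQuasiPoly (α : ℂ) (f : QuasiField) : Prop :=
  ∃ p : ℂ[X][X], f = xpow α * evalLog p

/-- `f` is a log-free quasi-polynomial of type `α`: `f(x) = x ^ α * p(x)`. -/
def IsLogFree (α : ℂ) (f : QuasiField) : Prop :=
  ∃ p : ℂ[X], f = xpow α * ofPoly p

/-- The polynomial `r(x)` divides the quasi-polynomial `f(x) = x ^ α * p(x, log x)` of type `α`: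
`r(x)` divides `p(x, s)`. -/
def DividesQuasi (r : ℂ[X]) (α : ℂ) (f : QuasiField) : Prop :=
  ∃ p : ℂ[X][X], f = xpow α * evalLog p ∧ Polynomial.C r ∣ p

/-! ### Powers of `q`, the shift `τ`, discrete Wronskians

Everywhere `logq` is the fixed value of `log q`. -/

/-- `q ^ α = exp (α * log q)`. -/
def qpow (logq α : ℂ) : ℂ := Complex.exp (α * logq)

/-- The operator `(τ f)(x) = f(x * q⁻²)`. -/
def tau (logq : ℂ) : QuasiField ≃+* QuasiField := shift (-2 * logq)

/-- The polynomial `r(x * q ^ α)`. -/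
def dilate (logq α : ℂ) (r : ℂ[X]) : ℂ[X] := r.comp (C (qpow logq α) * X)

/-- The discrete Wronskian `W_k[g₁, …, g_k](x) = det (g_i(x * q ^ (-2 (j - 1))))`. -/
def wronskian (logq : ℂ) {k : ℕ} (g : Fin k → QuasiField) : QuasiField :=
  (Matrix.of fun i j : Fin k => (tau logq)^[(j : ℕ)] (g i)).det

/-! ### Collections of quasi-polynomials, preframes -/

/-- Access to a finite sequence `a₁, …, a_m` by the index `1, …, m`; the value is `d` for any
other index. -/
def entry {m : ℕ} {R : Type*} (d : R) (a : Fin m → R) (k : ℕ) : R :=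
  if h : 1 ≤ k ∧ k ≤ m then a ⟨k - 1, by omega⟩ else d

variable {N : ℕ}

/-- A collection of quasi-polynomials `U = (u₁, …, u_N)` of type `lam = (λ₁, …, λ_N)`. -/
structure Collection (logq : ℂ) (lam : Fin N → ℂ) where
  u : Fin N → QuasiField
  isQuasiPoly : ∀ i, IsQuasiPoly (lam i) (u i)
  wronskian_ne_zero : wronskian logq u ≠ 0

/-- The collection is semiregular: `W_N[u₁, …, u_N]` is log-free. -/
def Collection.IsSemiregular {logq : ℂ} {lam : Fin N → ℂ} (U : Collection logq lam) : Prop :=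
  IsLogFree (∑ i, lam i) (wronskian logq U.u)

/-- `Q_k(x) = ∏_{i=1}^{k} ∏_{j=0}^{k-i} T_{N-i+1}(x * q ^ (-2 j))` for `T = (T₁, …, T_N)`. -/
def frameProd (logq : ℂ) (T : Fin N → ℂ[X]) (k : ℕ) : ℂ[X] :=
  ∏ i ∈ Finset.Icc 1 k, ∏ j ∈ Finset.range (k - i + 1),
    dilate logq (-2 * j) (entry 1 T (N - i + 1))

/-- `T = (T₁, …, T_N)` is a preframe of the (semiregular) collection `U`. -/
structure IsPreframe {logq : ℂ} {lam : Fin N → ℂ} (U : Collection logq lam)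
    (T : Fin N → ℂ[X]) : Prop where
  semiregular : U.IsSemiregular
  monic : ∀ i, (T i).Monic
  dvd_wronskian : ∀ k : ℕ, 1 ≤ k → k ≤ N - 1 → ∀ e : Fin k ↪o Fin N,
    DividesQuasi (frameProd logq T k) (∑ j, lam (e j)) (wronskian logq fun j => U.u (e j))
  wronskian_eq : ∃ c : ℂ,
    wronskian logq U.u = xpow (∑ i, lam i) * ofPoly (C c * frameProd logq T N)

/-- The sequence `(T₁, …, T_{N-1}, 1)`. -/
def withOne (T : Fin (N - 1) → ℂ[X]) : Fin N → ℂ[X] := fun i => entry 1 T ((i : ℕ) + 1)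

/-- `W_{N-i}[u_{i+1}, …, u_N]`. -/
def tailWronskian (logq : ℂ) (u : Fin N → QuasiField) (i : ℕ) : QuasiField :=
  wronskian logq fun j : Fin (N - i) => u ⟨i + j, by omega⟩

/-- `y_i`, defined by `W_{N-i}[u_{i+1}, …, u_N] = y_i * Q_{N-i}`. -/
def Collection.y {logq : ℂ} {lam : Fin N → ℂ} (U : Collection logq lam)
    (T : Fin N → ℂ[X]) (i : ℕ) : QuasiField :=
  tailWronskian logq U.u i / ofPoly (frameProd logq T (N - i))

/-- `λ_{i+1} + … + λ_N`, the type of `y_i`. -/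
def tailWeight (lam : Fin N → ℂ) (i : ℕ) : ℂ :=
  ∑ k ∈ Finset.Icc (i + 1) N, entry 0 lam k

/-- The semiregular collection `U` with preframe `T` is regular: `y₁, …, y_{N-1}` are log-free. -/
def Collection.IsRegular {logq : ℂ} {lam : Fin N → ℂ} (U : Collection logq lam)
    (T : Fin N → ℂ[X]) : Prop :=
  U.IsSemiregular ∧ ∀ i : ℕ, 1 ≤ i → i ≤ N - 1 → IsLogFree (tailWeight lam i) (U.y T i)

/-! ### Points `t = (t^{(i)}_j)` and their orbits -/

/-- The space `ℂ^{l₁} ⊕ … ⊕ ℂ^{l_{N-1}}` of points `t`; the coordinate `t^{(i)}_j` is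
`t ⟨i - 1, _⟩ ⟨j - 1, _⟩`. -/
abbrev Point (l : Fin (N - 1) → ℕ) : Type := (i : Fin (N - 1)) → Fin (l i) → ℂ

/-- The orbit of `t` under `S_{l₁} × … × S_{l_{N-1}}`, as a set of pairs `(l, s)` with `s` in
`ℂ^{l₁} ⊕ … ⊕ ℂ^{l_{N-1}}`. -/
def orbit {l : Fin (N - 1) → ℕ} (t : Point l) : Set (Σ m : Fin (N - 1) → ℕ, Point m) :=
  Set.range fun σ : (i : Fin (N - 1)) → Equiv.Perm (Fin (l i)) =>
    ⟨l, fun i j => t i (σ i j)⟩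

/-- `y_i(x) = c_i * x ^ (λ_{i+1} + … + λ_N) * ∏_{j=1}^{l_i} (x - t^{(i)}_j)` for `i = 1, …, N - 1`
and some nonzero `c_i`. -/
def IsRootPoint {logq : ℂ} {lam : Fin N → ℂ} (U : Collection logq lam) (T : Fin N → ℂ[X])
    {l : Fin (N - 1) → ℕ} (t : Point l) : Prop :=
  ∀ i : Fin (N - 1), ∃ c : ℂ, c ≠ 0 ∧
    U.y T (i + 1) =
      xpow (tailWeight lam (i + 1)) * ofPoly (C c * ∏ j : Fin (l i), (X - C (t i j)))

/-- `X_{U,T}`: the orbit of the point formed by the roots of the polynomials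
`x ^ (-λ_{i+1} - … - λ_N) * y_i(x)`. The enumeration of the roots does not matter. -/
def rootOrbit {logq : ℂ} {lam : Fin N → ℂ} (U : Collection logq lam) (T : Fin N → ℂ[X]) :
    Set (Σ m : Fin (N - 1) → ℕ, Point m) :=
  {P | ∃ (l : Fin (N - 1) → ℕ) (t : Point l), IsRootPoint U T t ∧ P ∈ orbit t}

theorem evalLog_injective : Function.Injective evalLog := by
  have h1 : Function.Injective
      (Polynomial.aeval (AddMonoidAlgebra.single (1 : ℂ) (1 : ℂ)) :
        ℂ[X] →ₐ[ℂ] AddMonoidAlgebra ℂ ℂ) := by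
    rw [injective_iff_map_eq_zero]
    intro p hp
    ext n
    have h2 := congrArg (fun f : AddMonoidAlgebra ℂ ℂ => f.coeff (n : ℂ)) hp
    simp only [Polynomial.aeval_eq_sum_range, AddMonoidAlgebra.single_pow, one_pow, nsmul_eq_mul,
      mul_one, AddMonoidAlgebra.coeff_sum, Finsupp.finsetSum_apply, AddMonoidAlgebra.coeff_smul,
      AddMonoidAlgebra.coeff_single, Finsupp.smul_apply, Finsupp.single_apply] at h2
    by_cases hn : n ≤ p.natDegree
    · simpa [Nat.lt_succ_iff, hn] using h2
    · simpa using Polynomial.coeff_eq_zero_of_natDegree_lt (not_le.mp hn)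
  exact (IsFractionRing.injective QuasiRing QuasiField).comp (Polynomial.map_injective _ h1)

theorem ofPoly_injective : Function.Injective ofPoly :=
  evalLog_injective.comp Polynomial.C_injective

theorem xpow_ne_zero (α : ℂ) : xpow α ≠ 0 := by
  unfold xpow
  rw [Ne, FaithfulSMul.algebraMap_eq_zero_iff, Polynomial.C_eq_zero]
  simp

/-- `X_{U,T}` is a single orbit, the orbit of any point formed by the roots. -/
theorem rootOrbit_eq {logq : ℂ} {lam : Fin N → ℂ} {U : Collection logq lam} {T : Fin N → ℂ[X]}
    {l : Fin (N - 1) → ℕ} {t : Point l} (ht : IsRootPoint U T t) :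
    rootOrbit U T = orbit t := by
  have key : ∀ {m m' : ℕ} (a : Fin m → ℂ) (b : Fin m' → ℂ) (c d : ℂ), c ≠ 0 → d ≠ 0 →
      C c * ∏ j, (X - C (a j)) = C d * ∏ j, (X - C (b j)) →
      Multiset.map a Finset.univ.val = Multiset.map b Finset.univ.val := by
    intro m m' a b c d hc hd h
    have := congrArg Polynomial.roots h
    rw [Polynomial.roots_C_mul _ hc, Polynomial.roots_C_mul _ hd] at this
    have hr : ∀ {n : ℕ} (e : Fin n → ℂ), (∏ j, (X - C (e j))).roots =
        Multiset.map e Finset.univ.val := by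
      intro n e
      rw [← Polynomial.roots_multiset_prod_X_sub_C (Multiset.map e Finset.univ.val),
        Multiset.map_map]
      rfl
    rwa [hr, hr] at this
  ext P
  constructor
  · rintro ⟨m, s, hs, hP⟩
    have hms : ∀ i, Multiset.map (s i) Finset.univ.val = Multiset.map (t i) Finset.univ.val := by
      intro i
      obtain ⟨c, hc, h1⟩ := hs i
      obtain ⟨d, hd, h2⟩ := ht i
      exact key _ _ c d hc hd (ofPoly_injective (mul_left_cancel₀ (xpow_ne_zero _) (h1.symm.trans h2)))
    obtain rfl : m = l := by
      funext i
      simpa using congrArg Multiset.card (hms i)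
    have hperm : ∀ i, ∃ σ : Equiv.Perm (Fin (m i)), s i = t i ∘ σ := by
      intro i
      have hc : ∀ z, Fintype.card {a // s i a = z} = Fintype.card {a // t i a = z} := by
        intro z
        have h := congrArg (Multiset.count z) (hms i)
        simp only [Multiset.count_map] at h
        rw [Fintype.card_subtype, Fintype.card_subtype]
        simpa [Finset.card, Finset.filter_val, eq_comm] using h
      refine ⟨Equiv.ofFiberEquiv fun z => Fintype.equivOfCardEq (hc z), ?_⟩
      funext a
      exact (Equiv.ofFiberEquiv_map _ a).symm
    choose τ hτ using hperm
    obtain ⟨σ, rfl⟩ := hP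
    refine ⟨fun i => (σ i).trans (τ i), ?_⟩
    simp [hτ]
  · exact fun h => ⟨l, t, ht, h⟩

/-! ### Bethe ansatz equations -/

/-- `∏_{r=1}^{l_k} F(t^{(k)}_r)`, which is `1` for `k = 0` and `k = N` (as `l₀ = l_N = 0`). -/
def coordProd {R : Type*} [CommMonoid R] {l : Fin (N - 1) → ℕ} (t : Point l) (k : ℕ)
    (F : ℂ → R) : R :=
  if h : 1 ≤ k ∧ k ≤ N - 1 then
    ∏ r : Fin (l ⟨k - 1, by omega⟩), F (t ⟨k - 1, by omega⟩ r)
  else 1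

/-- The Bethe ansatz equations with data `l`, `T = (T₁, …, T_{N-1})`, `lam = (λ₁, …, λ_N)`.
Here `i : Fin (N - 1)` stands for the superscript `i + 1`, so the neighbouring superscripts are
`i` and `i + 2`. -/
def IsBetheSolution (logq : ℂ) (lam : Fin N → ℂ) (T : Fin (N - 1) → ℂ[X])
    {l : Fin (N - 1) → ℕ} (t : Point l) : Prop :=
  ∀ (i : Fin (N - 1)) (j : Fin (l i)),
    let q := qpow logq 1
    let x := t i j
    (T i).eval (x * q ^ 2) *
        coordProd t i (fun s => x * q - s * q⁻¹) *
        coordProd t (i + 2) (fun s => x - s) *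
        ∏ k ∈ Finset.univ.erase j, (x * q⁻¹ - t i k * q) =
      qpow logq (2 * (entry 0 lam (i + 2) - entry 0 lam (i + 1) + (l i : ℂ)) -
          ((entry 0 l i : ℕ) : ℂ) - ((entry 0 l (i + 2) : ℕ) : ℂ)) *
        (T i).eval x *
        coordProd t i (fun s => x - s) *
        coordProd t (i + 2) (fun s => x * q⁻¹ - s * q) *
        ∏ k ∈ Finset.univ.erase j, (x * q - t i k * q⁻¹)

/-- `p_k(x; t) = ∏_{j=1}^{l_k} (x - t^{(k)}_j)`, with `p_0 = p_N = 1`. -/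
def pPoly {l : Fin (N - 1) → ℕ} (t : Point l) (k : ℕ) : ℂ[X] :=
  coordProd t k fun s => X - C s

/-- The polynomial
`P_i(x; t) = q^{2λ_{i+1}} p_i(xq²) p_{i-1}(x) p_{i+1}(xq⁻²) T_i(x)
  + q^{2λ_i} p_i(xq⁻²) p_{i-1}(xq²) p_{i+1}(x) T_i(xq²)`. -/
def bethePoly (logq : ℂ) (lam : Fin N → ℂ) (T : Fin (N - 1) → ℂ[X])
    {l : Fin (N - 1) → ℕ} (t : Point l) (i : ℕ) : ℂ[X] :=
  C (qpow logq (2 * entry 0 lam (i + 1))) * dilate logq 2 (pPoly t i) * pPoly t (i - 1) *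
      dilate logq (-2) (pPoly t (i + 1)) * entry 1 T i +
    C (qpow logq (2 * entry 0 lam i)) * dilate logq (-2) (pPoly t i) *
      dilate logq 2 (pPoly t (i - 1)) * pPoly t (i + 1) * dilate logq 2 (entry 1 T i)

/-- Regular solutions of the Bethe ansatz equations: whenever the coordinates `t^{(i)}_j`, `j ∈ I`,
have a common value `a`, the derivatives of `P_i` of orders `0, …, |I| - 1` vanish at `a`. -/
def IsRegularSolution (logq : ℂ) (lam : Fin N → ℂ) (T : Fin (N - 1) → ℂ[X])
    {l : Fin (N - 1) → ℕ} (t : Point l) : Prop :=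
  IsBetheSolution logq lam T t ∧
    ∀ (i : Fin (N - 1)) (I : Finset (Fin (l i))) (a : ℂ), (∀ j ∈ I, t i j = a) →
      ∀ k < I.card, (derivative^[k] (bethePoly logq lam T t (i + 1))).eval a = 0

/-- Admissible points: `t^{(i)}_j ≠ t^{(i)}_k q²` for all `i`, `j`, `k` (including `j = k`). -/
def IsAdmissible (logq : ℂ) {l : Fin (N - 1) → ℕ} (t : Point l) : Prop :=
  ∀ (i : Fin (N - 1)) (j k : Fin (l i)), t i j ≠ t i k * qpow logq 2

/-- `lam` is generic: `q ^ (2 (λ_i - λ_j)) ≠ q ^ (2 s)` for all `i < j` and integers `s`. -/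
def IsGenericWeight (logq : ℂ) (lam : Fin N → ℂ) : Prop :=
  ∀ i j : Fin N, i < j → ∀ s : ℤ, qpow logq (2 * (lam i - lam j)) ≠ qpow logq (2 * s)

/-! ### Difference operators

Difference operators act on `QuasiField`; `τ` has infinite order, so the coefficients of
`a₀ + a₁ τ + … + a_N τ ^ N` are determined by its action. -/

/-- `D = a₀ + a₁ τ + … + a_{N-1} τ ^ (N-1) + τ ^ N`. -/
def IsMonicDifferenceOp (logq : ℂ) (N : ℕ) (D : QuasiField → QuasiField) : Prop :=
  ∃ a : Fin N → QuasiField, ∀ f,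
    D f = ∑ j : Fin N, a j * (tau logq)^[(j : ℕ)] f + (tau logq)^[N] f

/-- The fundamental difference operator
`D_U f = W_{N+1}[u₁, …, u_N, f] / W_N[u₁, …, u_N]` of a collection `U`. -/
def Collection.fundamentalOp {logq : ℂ} {lam : Fin N → ℂ} (U : Collection logq lam)
    (f : QuasiField) : QuasiField :=
  wronskian logq (Fin.snoc U.u f : Fin (N + 1) → QuasiField) / wronskian logq U.u

/-- `D_U` is a monic difference operator of order `N`. -/
theorem Collection.fundamentalOp_isMonic {logq : ℂ} {lam : Fin N → ℂ}
    (U : Collection logq lam) : IsMonicDifferenceOp logq N U.fundamentalOp := by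
  have hW := U.wronskian_ne_zero
  refine ⟨fun j => (-1) ^ (N + (j : ℕ)) *
    (Matrix.of fun i k : Fin N => (tau logq)^[(j.castSucc.succAbove k : ℕ)] (U.u i)).det /
      wronskian logq U.u, fun f => ?_⟩
  unfold Collection.fundamentalOp
  rw [wronskian, Matrix.det_succ_row _ (Fin.last N), Fin.sum_univ_castSucc, add_div,
    Finset.sum_div]
  congr 1
  · refine Finset.sum_congr rfl fun j _ => ?_
    have : (Matrix.of fun i j : Fin (N + 1) => (tau logq)^[(j : ℕ)]
        ((Fin.snoc U.u f : Fin (N + 1) → QuasiField) i)).submatrix (Fin.last N).succAbove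
          j.castSucc.succAbove =
        Matrix.of fun i k : Fin N => (tau logq)^[(j.castSucc.succAbove k : ℕ)] (U.u i) := by
      ext a b
      simp [Matrix.submatrix_apply, Fin.succAbove_last]
    rw [this]
    simp only [Matrix.of_apply, Fin.snoc_last, Fin.val_last, Fin.val_castSucc]
    ring
  · have : (Matrix.of fun i j : Fin (N + 1) => (tau logq)^[(j : ℕ)]
        ((Fin.snoc U.u f : Fin (N + 1) → QuasiField) i)).submatrix (Fin.last N).succAbove
          (Fin.last N).succAbove =
        Matrix.of fun i k : Fin N => (tau logq)^[(k : ℕ)] (U.u i) := by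
      ext a b
      simp [Matrix.submatrix_apply, Fin.succAbove_last]
    rw [this]
    simp only [Matrix.of_apply, Fin.snoc_last, Fin.val_last, ← two_mul, pow_mul]
    rw [← wronskian]
    field_simp
    simp

/-- `D_U u_i = 0`. -/
theorem Collection.fundamentalOp_apply {logq : ℂ} {lam : Fin N → ℂ}
    (U : Collection logq lam) (i : Fin N) : U.fundamentalOp (U.u i) = 0 := by
  unfold Collection.fundamentalOp
  rw [wronskian, Matrix.det_zero_of_row_eq (i := i.castSucc) (j := Fin.last N)
    (Fin.castSucc_lt_last i).ne, zero_div]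
  funext k
  simp

/-- `D_U` is the only monic difference operator of order `N` with `D u_i = 0` for all `i`. -/
theorem Collection.eq_fundamentalOp {logq : ℂ} {lam : Fin N → ℂ} (U : Collection logq lam)
    {D : QuasiField → QuasiField} (hD : IsMonicDifferenceOp logq N D)
    (h : ∀ i, D (U.u i) = 0) : D = U.fundamentalOp := by
  obtain ⟨a, ha⟩ := hD
  obtain ⟨b, hb⟩ := U.fundamentalOp_isMonic
  have hW := U.wronskian_ne_zero
  have hab : a - b = 0 := by
    refine Matrix.eq_zero_of_mulVec_eq_zero hW ?_
    funext i
    have h1 := h i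
    have h2 := U.fundamentalOp_apply i
    rw [ha] at h1
    rw [hb] at h2
    have h3 := sub_eq_zero.mpr (h1.trans h2.symm)
    rw [add_sub_add_right_eq_sub, ← Finset.sum_sub_distrib] at h3
    simp only [Matrix.mulVec, dotProduct, Matrix.of_apply, Pi.sub_apply, Pi.zero_apply]
    rw [← h3]
    exact Finset.sum_congr rfl fun j _ => by ring
  funext f
  rw [ha, hb, sub_eq_zero.mp hab]

/-- `R_i(x) = p_{i-1}(x) / p_i(x) * ∏_{j=i}^{N-1} T_j(x * q ^ (2 (i - j)))`. -/
def pointRatio (logq : ℂ) (T : Fin (N - 1) → ℂ[X]) {l : Fin (N - 1) → ℕ} (t : Point l)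
    (i : ℕ) : QuasiField :=
  ofPoly (pPoly t (i - 1)) / ofPoly (pPoly t i) *
    ofPoly (∏ j ∈ Finset.Icc i (N - 1), dilate logq (2 * ((i : ℂ) - j)) (entry 1 T j))

/-- The first order difference operator `τ - a`. -/
def firstOrderOp (logq : ℂ) (a : QuasiField) : AddMonoid.End QuasiField :=
  (tau logq).toAddMonoidHom - AddMonoidHom.mulLeft a

/-- The fundamental difference operator of the point `t`,
`D^t = (τ - q^{-2λ₁} R₁(xq⁻²)/R₁(x)) ⋯ (τ - q^{-2λ_N} R_N(xq⁻²)/R_N(x))`; the product of operators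
is their composition. -/
def pointOp (logq : ℂ) (lam : Fin N → ℂ) (T : Fin (N - 1) → ℂ[X]) {l : Fin (N - 1) → ℕ}
    (t : Point l) : AddMonoid.End QuasiField :=
  ((List.finRange N).map fun i : Fin N =>
    firstOrderOp logq (ofPoly (C (qpow logq (-2 * lam i))) *
      (tau logq (pointRatio logq T t (i + 1)) / pointRatio logq T t (i + 1)))).prod

end XXZ

end

/-! The factors of `D^t` are first-order operators `τ - κ_i R_i(xq⁻²)/R_i(x)` with `κ_i =
q^{-2λ_i}`. Dividing by `R_i` turns a kernel element into a `τ`-eigenfunction with eigenvalue `κ_i`.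
Among rational quasi-polynomials of type `λ_b`, genericity leaves only multiples of `x^{λ_i} R_i`,
and only for `b = i` (`kernel_factorOp`). Hence peeling factors off `D^t u_b = 0` from the left
kills the image of `u_b` until the `b`-th factor is reached, where a multiple of `x^{λ_b} R_b`
appears.

Undoing the remaining factors means solving `κ_b p_i(x) z_{i+1}(xq⁻²) - κ_{i+1} p_i(xq⁻²) z_{i+1}(x)
= z_i(x) T_i(x) p_{i+1}(xq⁻²)` in polynomials, starting from `z = p_{b-1}`. Regularity gives `p_i ∣
P_i`, which together with admissibility (`p_i` coprime to `p_i(xq²)`) makes one step solvable, and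
the divisibility passes on to the next step (`exists_wronskian_solution`, `dvd_of_wronskian_eq`,
`exists_chain`). So `u_b` is a multiple of `x^{λ_b} z_N`; in particular it is log-free.

A monic operator `D` of order `k` annihilating `g₁, …, g_k` satisfies `W[f, g₁, …, g_k] = ± D f ·
W[g₁, …, g_k]`. Applied to right factors of `D^t`, this gives `W[u_{i+1}, …, u_N] = const · x^{…}
p_i Q_{N-i}` (`wronskian_lastTerms`), whence `y_i` is `p_i` up to a power and a constant, and the
orbit is that of `t`.

For an arbitrary Wronskian `W_{k+1}[u_e]`, a Plücker relation against the last `k` functions shows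
by induction that `Q_{k+1}` divides `p_{N-k} W_{k+1}[u_e]`. A second relation gives the same with
`p_{N-k}(xq⁻²)`, and coprimality removes both cofactors (`dvd_wronskian`). -/

noncomputable section

namespace XXZ

/-! ### Dilations of polynomials. -/

section Dilate

variable (logq : ℂ)

theorem qpow_add (a b : ℂ) : qpow logq (a + b) = qpow logq a * qpow logq b := by
  simp [qpow, add_mul, Complex.exp_add]

theorem qpow_zero : qpow logq 0 = 1 := by simp [qpow]

theorem qpow_ne_zero (a : ℂ) : qpow logq a ≠ 0 := Complex.exp_ne_zero _

theorem qpow_neg_mul (a : ℂ) : qpow logq (-a) * qpow logq a = 1 := by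
  rw [← qpow_add, neg_add_cancel, qpow_zero]

theorem dilate_mul (a : ℂ) (r s : ℂ[X]) :
    dilate logq a (r * s) = dilate logq a r * dilate logq a s := mul_comp ..

theorem dilate_add (a : ℂ) (r s : ℂ[X]) :
    dilate logq a (r + s) = dilate logq a r + dilate logq a s := add_comp

theorem dilate_sub (a : ℂ) (r s : ℂ[X]) :
    dilate logq a (r - s) = dilate logq a r - dilate logq a s := sub_comp

theorem dilate_C (a c : ℂ) : dilate logq a (C c) = C c := C_comp

theorem dilate_one (a : ℂ) : dilate logq a 1 = 1 := one_comp

theorem dilate_prod {ι : Type*} (a : ℂ) (s : Finset ι) (f : ι → ℂ[X]) :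
    dilate logq a (∏ i ∈ s, f i) = ∏ i ∈ s, dilate logq a (f i) := prod_comp ..

theorem dilate_dilate (a b : ℂ) (r : ℂ[X]) :
    dilate logq a (dilate logq b r) = dilate logq (a + b) r := by
  unfold dilate
  rw [comp_assoc]
  simp only [mul_comp, C_comp, X_comp, ← mul_assoc, ← C_mul]
  rw [← qpow_add, add_comm]

theorem dilate_zero (r : ℂ[X]) : dilate logq 0 r = r := by
  simp [dilate, qpow_zero]

theorem coeff_dilate (a : ℂ) (r : ℂ[X]) (n : ℕ) :
    (dilate logq a r).coeff n = r.coeff n * qpow logq a ^ n := by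
  unfold dilate
  rw [comp_C_mul_X_coeff]

theorem dilate_ne_zero {a : ℂ} {r : ℂ[X]} (hr : r ≠ 0) : dilate logq a r ≠ 0 := by
  intro h
  apply hr
  have := congrArg (dilate logq (-a)) h
  rw [dilate_dilate, neg_add_cancel, dilate_zero] at this
  rw [this, dilate, zero_comp]

theorem dilate_dvd {a : ℂ} {r s : ℂ[X]} (h : r ∣ s) : dilate logq a r ∣ dilate logq a s := by
  obtain ⟨c, rfl⟩ := h
  exact ⟨_, dilate_mul ..⟩

theorem isCoprime_dilate {a : ℂ} {r s : ℂ[X]} (h : IsCoprime r s) :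
    IsCoprime (dilate logq a r) (dilate logq a s) := by
  obtain ⟨u, v, h⟩ := h
  refine ⟨dilate logq a u, dilate logq a v, ?_⟩
  rw [← dilate_mul, ← dilate_mul, ← dilate_add, h, dilate_one]

theorem natTrailingDegree_dilate (a : ℂ) (r : ℂ[X]) :
    (dilate logq a r).natTrailingDegree = r.natTrailingDegree := by
  by_cases hr : r = 0
  · simp [hr, dilate]
  refine le_antisymm (natTrailingDegree_le_of_ne_zero ?_)
    (le_natTrailingDegree (dilate_ne_zero logq hr) fun m hm => ?_)
  · rw [coeff_dilate]
    exact mul_ne_zero (trailingCoeff_nonzero_iff_nonzero.2 hr) (pow_ne_zero _ (qpow_ne_zero _ _))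
  · rw [coeff_dilate, coeff_eq_zero_of_lt_natTrailingDegree hm, zero_mul]

theorem trailingCoeff_dilate (a : ℂ) (r : ℂ[X]) :
    (dilate logq a r).trailingCoeff = r.trailingCoeff * qpow logq a ^ r.natTrailingDegree := by
  rw [trailingCoeff, natTrailingDegree_dilate, coeff_dilate, trailingCoeff]

end Dilate

/-! ### The action of `τ` on powers of `x` and on polynomials in `x` and `log x`. -/

section Shift

variable (logq : ℂ)

theorem xpow_add (a b : ℂ) : xpow (a + b) = xpow a * xpow b := by
  unfold xpow
  rw [← map_mul, ← map_mul, AddMonoidAlgebra.single_mul_single, mul_one]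

theorem xpow_zero : xpow 0 = 1 := by
  unfold xpow
  rw [← AddMonoidAlgebra.one_def, map_one, map_one]

theorem evalLog_C (r : ℂ[X]) : evalLog (C r) = ofPoly r := rfl

theorem ofPoly_ne_zero {r : ℂ[X]} (h : r ≠ 0) : ofPoly r ≠ 0 :=
  (map_ne_zero_iff _ ofPoly_injective).2 h

theorem ofPoly_C (c : ℂ) : ofPoly (C c) = algebraMap QuasiRing QuasiField
    (Polynomial.C (AddMonoidAlgebra.single 0 c)) := by
  simp [ofPoly, evalLog]

theorem tau_xpow (a : ℂ) : tau logq (xpow a) = ofPoly (C (qpow logq (-2 * a))) * xpow a := by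
  rw [ofPoly_C, xpow, tau, shift_algebraMap, shiftHom_single, ← map_mul, ← map_mul,
    AddMonoidAlgebra.single_mul_single]
  simp [qpow]
  ring_nf

/-- The substitution `x ↦ x * q⁻²`, `s ↦ s - 2 * log q` in polynomials in `s = log x`. -/
def shiftPoly : ℂ[X][X] →+* ℂ[X][X] :=
  eval₂RingHom (C.comp (compRingHom (C (qpow logq (-2)) * X))) (X + C (C (-2 * logq)))

theorem shiftPoly_C (r : ℂ[X]) : shiftPoly logq (C r) = C (dilate logq (-2) r) := by
  simp [shiftPoly, dilate]

/-- Both sides are ring homomorphisms in `P`, so constants, `x` and `log x` suffice. -/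
theorem tau_evalLog (P : ℂ[X][X]) : tau logq (evalLog P) = evalLog (shiftPoly logq P) := by
  suffices h : (tau logq).toRingHom.comp evalLog = evalLog.comp (shiftPoly logq) from
    congrArg (fun f => f P) h
  refine Polynomial.ringHom_ext' (Polynomial.ringHom_ext' (RingHom.ext fun b => ?_) ?_) ?_
  · have h : evalLog (C (C b)) = _ := ofPoly_C b
    simp only [RingHom.comp_apply, RingEquiv.toRingHom_eq_coe, RingEquiv.coe_toRingHom,
      shiftPoly_C, dilate_C, h]
    rw [tau, shift_algebraMap, shiftHom_single]
    simp
  · have h : evalLog (C X) = xpow 1 := by simp [evalLog, xpow]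
    simp only [RingHom.comp_apply, RingEquiv.toRingHom_eq_coe, RingEquiv.coe_toRingHom,
      shiftPoly_C, dilate, X_comp, h, map_mul, tau_xpow]
    rw [mul_one, ← evalLog_C]
  · have h : evalLog X = algebraMap QuasiRing QuasiField X := by simp [evalLog]
    have h' : evalLog (C (C (-2 * logq))) = _ := ofPoly_C (-2 * logq)
    simp only [RingHom.comp_apply, RingEquiv.toRingHom_eq_coe, RingEquiv.coe_toRingHom,
      shiftPoly, coe_eval₂RingHom, eval₂_X, map_add, h, h']
    rw [tau, shift_algebraMap, shiftHom_X, map_add]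

theorem tau_ofPoly (r : ℂ[X]) : tau logq (ofPoly r) = ofPoly (dilate logq (-2) r) := by
  rw [← evalLog_C, tau_evalLog, shiftPoly_C, evalLog_C]

end Shift

/-! ### Eigenfunctions of `τ` among rational functions with logarithms. -/

section Eigen

variable {logq : ℂ} (hq : Function.Injective fun n : ℕ => qpow logq (-2) ^ n)

/-- The lowest term of each polynomial scales by a power of `q⁻²`; compare the lowest coefficients
of the two sides. -/
theorem trailing_eq_of_eigen {κ : ℂ} {r Q : ℂ[X]} (hr : r ≠ 0) (hQ : Q ≠ 0)
    (h : C κ * dilate logq (-2) r * Q = dilate logq (-2) Q * r) :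
    κ * qpow logq (-2) ^ r.natTrailingDegree = qpow logq (-2) ^ Q.natTrailingDegree := by
  have h1 := congrArg trailingCoeff h
  have e : (C κ).trailingCoeff = κ := by simp [trailingCoeff]
  simp only [trailingCoeff_mul, trailingCoeff_dilate, e] at h1
  have hr' : r.trailingCoeff ≠ 0 := trailingCoeff_nonzero_iff_nonzero.2 hr
  have hQ' : Q.trailingCoeff ≠ 0 := trailingCoeff_nonzero_iff_nonzero.2 hQ
  apply mul_right_cancel₀ (mul_ne_zero hr' hQ')
  linear_combination h1

include hq in
-- The quotient `r/Q` is invariant under `x ↦ xq⁻²`, hence constant because the powers of `q⁻²` are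
-- distinct.
theorem eq_C_mul_of_dilate_mul_eq {r Q : ℂ[X]} (hQ : Q ≠ 0)
    (h : dilate logq (-2) r * Q = dilate logq (-2) Q * r) : ∃ c, r = C c * Q := by
  have hQ' : Q.trailingCoeff ≠ 0 := trailingCoeff_nonzero_iff_nonzero.2 hQ
  set n := Q.natTrailingDegree with hn
  have hQn : Q.coeff n ≠ 0 := hQ'
  refine ⟨r.coeff n / Q.coeff n, ?_⟩
  rw [← sub_eq_zero]
  -- This `c` cancels the coefficient at the lowest degree of `Q`, exactly the degree in which a
  -- nonzero difference would have to start.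
  set c := r.coeff n / Q.coeff n with hc
  by_contra h0
  have h1 : C 1 * dilate logq (-2) (r - C c * Q) * Q = dilate logq (-2) Q * (r - C c * Q) := by
    rw [dilate_sub, dilate_mul, dilate_C, C_1]
    linear_combination h
  have h2 := trailing_eq_of_eigen h0 hQ h1
  rw [one_mul] at h2
  have h3 := hq h2
  apply trailingCoeff_nonzero_iff_nonzero.2 h0
  rw [trailingCoeff, h3, ← hn, coeff_sub, coeff_C_mul, hc, div_mul_cancel₀ _ hQn, sub_self]

include hq in
-- A rational function `p/Q` cannot grow by a nonzero constant `e` under `x ↦ xq⁻²`; only a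
-- logarithm does.
theorem eq_zero_of_dilate_sub_eq {p Q : ℂ[X]} {e : ℂ} (hQ : Q ≠ 0)
    (h : dilate logq (-2) p * Q - dilate logq (-2) Q * p = C e * (dilate logq (-2) Q * Q)) :
    e = 0 := by
  by_contra he
  have hQ' : Q.trailingCoeff ≠ 0 := trailingCoeff_nonzero_iff_nonzero.2 hQ
  set n := Q.natTrailingDegree with hn
  have hQn : Q.coeff n ≠ 0 := hQ'
  set c := p.coeff n / Q.coeff n with hc
  obtain ⟨r, hr⟩ : ∃ r, r = p - C c * Q := ⟨_, rfl⟩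
  have h1 : dilate logq (-2) r * Q - dilate logq (-2) Q * r =
      C e * (dilate logq (-2) Q * Q) := by
    rw [hr, dilate_sub, dilate_mul, dilate_C]
    linear_combination h
  have hrn : r.coeff n = 0 := by
    rw [hr, coeff_sub, coeff_C_mul, hc, div_mul_cancel₀ _ hQn, sub_self]
  have hdQ := dilate_ne_zero logq (a := -2) hQ
  have hr0 : r ≠ 0 := by
    intro h0
    rw [h0, dilate, zero_comp, zero_mul, mul_zero, sub_zero] at h1
    exact mul_ne_zero (C_ne_zero.2 he) (mul_ne_zero hdQ hQ) h1.symm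
  have hr' : r.trailingCoeff ≠ 0 := trailingCoeff_nonzero_iff_nonzero.2 hr0
  set k := r.natTrailingDegree with hk
  have hkn : k ≠ n := fun hkn => hr' (by rw [trailingCoeff, ← hk, hkn, hrn])
  have hm : ∀ a b : ℂ[X], (dilate logq (-2) a * b).coeff
      (a.natTrailingDegree + b.natTrailingDegree) =
      a.trailingCoeff * qpow logq (-2) ^ a.natTrailingDegree * b.trailingCoeff := by
    intro a b
    rw [← trailingCoeff_dilate, ← natTrailingDegree_dilate logq (-2) a,
      coeff_mul_natTrailingDegree_add_natTrailingDegree]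
  have hz : ∀ {a b : ℂ[X]} {m : ℕ}, a ≠ 0 → b ≠ 0 →
      m < a.natTrailingDegree + b.natTrailingDegree → (dilate logq (-2) a * b).coeff m = 0 :=
    fun ha hb hm => coeff_eq_zero_of_lt_natTrailingDegree (by
      rwa [natTrailingDegree_mul (dilate_ne_zero logq ha) hb, natTrailingDegree_dilate])
  have hqn := pow_ne_zero n (qpow_ne_zero logq (-2))
  -- If `k < n`, the left side has a term in degree `k + n`, below everything on the right. If `k >
  -- n`, the right side has a term in degree `2n`, below everything on the left.
  rcases lt_or_gt_of_ne hkn with hlt | hlt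
  · have := congrArg (fun f => f.coeff (k + n)) h1
    have c2 := hm Q r
    rw [add_comm] at c2
    simp only [coeff_sub, coeff_C_mul] at this
    rw [hz hQ hQ (by omega), mul_zero, hm r Q, c2] at this
    apply hkn
    apply hq
    simp only
    apply mul_right_cancel₀ (mul_ne_zero hr' hQ')
    linear_combination this
  · have := congrArg (fun f => f.coeff (n + n)) h1
    simp only [coeff_sub, coeff_C_mul] at this
    rw [hz hr0 hQ (by omega), hz hQ hr0 (by omega), sub_zero, hm Q Q] at this
    exact mul_ne_zero he (mul_ne_zero (mul_ne_zero hQ' hqn) hQ') this.symm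

theorem shiftPoly_eq_taylor (P : ℂ[X][X]) : shiftPoly logq P =
    taylor (C (-2 * logq)) (P.map (compRingHom (C (qpow logq (-2)) * X))) := by
  rw [shiftPoly, coe_eval₂RingHom, taylor_apply, comp, eval₂_map]

theorem natDegree_map_dilate (P : ℂ[X][X]) :
    (P.map (compRingHom (C (qpow logq (-2)) * X))).natDegree = P.natDegree :=
  natDegree_map_eq_of_injective ((injective_iff_map_eq_zero _).2 fun r hr => by
    by_contra h
    exact dilate_ne_zero logq h hr) P

theorem coeff_shiftPoly_natDegree (P : ℂ[X][X]) :
    (shiftPoly logq P).coeff P.natDegree = dilate logq (-2) P.leadingCoeff := by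
  rw [shiftPoly_eq_taylor, ← natDegree_map_dilate (logq := logq) P, coeff_taylor_natDegree,
    leadingCoeff, coeff_map, natDegree_map_dilate]
  rfl

/-- The Hasse derivative of order `d` has degree at most one in `s`, so only two coefficients
contribute. -/
theorem coeff_shiftPoly_pred {P : ℂ[X][X]} {d : ℕ} (hd : P.natDegree = d + 1) :
    (shiftPoly logq P).coeff d = dilate logq (-2) (P.coeff d) +
      C ((d + 1) * (-2 * logq)) * dilate logq (-2) (P.coeff (d + 1)) := by
  rw [shiftPoly_eq_taylor, taylor_coeff, eval_eq_sum_range' (n := 2)]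
  · simp [Finset.sum_range_succ, hasseDeriv_coeff, coeff_map, dilate, add_comm 1 d,
      Nat.choose_succ_self_right]
    ring
  · refine (natDegree_hasseDeriv_le _ _).trans_lt ?_
    rw [natDegree_map_dilate, hd]
    omega

include hq in
-- The top coefficient of `P` in `s = log x` satisfies the same equation without logarithms, which
-- restricts `κ`. For `κ = 1` it equals `c Q`; if the degree in `s` were positive, the next
-- coefficient divided by `Q` would grow by a nonzero multiple of `c log q`, forcing `c = 0`.
theorem eigen_shiftPoly (hlogq : logq ≠ 0) {κ : ℂ} {P : ℂ[X][X]} {Q : ℂ[X]}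
    (hP : P ≠ 0) (hQ : Q ≠ 0)
    (h : C (C κ) * shiftPoly logq P * C Q = C (dilate logq (-2) Q) * P) :
    (∃ m n : ℕ, κ * qpow logq (-2) ^ m = qpow logq (-2) ^ n) ∧
      (κ = 1 → ∃ c, P = C (C c * Q)) := by
  have h1 := congrArg (fun f => f.coeff P.natDegree) h
  simp only [coeff_mul_C, coeff_C_mul, coeff_shiftPoly_natDegree, coeff_natDegree] at h1
  have hl : P.leadingCoeff ≠ 0 := leadingCoeff_ne_zero.2 hP
  refine ⟨⟨_, _, trailing_eq_of_eigen hl hQ h1⟩, ?_⟩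
  rintro rfl
  rw [C_1, one_mul] at h1
  obtain ⟨c, hc⟩ := eq_C_mul_of_dilate_mul_eq hq hQ h1
  refine ⟨c, ?_⟩
  obtain hd | ⟨d, hd⟩ : P.natDegree = 0 ∨ ∃ d, P.natDegree = d + 1 := by
    cases P.natDegree <;> simp
  · rw [← hc, leadingCoeff, hd]
    exact eq_C_of_natDegree_eq_zero hd
  exfalso
  have h2 := congrArg (fun f => f.coeff d) h
  rw [leadingCoeff, hd] at hc
  simp only [coeff_mul_C, coeff_C_mul, coeff_shiftPoly_pred hd, hc, dilate_mul, dilate_C,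
    C_1, one_mul] at h2
  have h3 := eq_zero_of_dilate_sub_eq hq (p := P.coeff d) (Q := Q)
    (e := 2 * (d + 1) * logq * c) hQ (by
      simp only [C_mul, C_neg] at h2 ⊢
      linear_combination h2)
  have hd' : ((d : ℂ) + 1) ≠ 0 := by exact_mod_cast d.succ_ne_zero
  have : c = 0 := by simpa [hd', hlogq] using h3
  rw [leadingCoeff, hd, hc, this] at hl
  simp at hl

end Eigen

/-! ### Polynomial solutions of the first-order difference equation. -/

section Solve

variable (logq : ℂ)

/-- The operator is diagonal on monomials, with eigenvalues `κ q^{-2n} - κ'`. -/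
theorem exists_dilate_sub_eq {κ κ' : ℂ} (hgen : ∀ n : ℕ, κ * qpow logq (-2) ^ n ≠ κ')
    (G : ℂ[X]) : ∃ g, C κ * dilate logq (-2) g - C κ' * g = G := by
  induction G using Polynomial.induction_on' with
  | add G H hG hH =>
    obtain ⟨g, rfl⟩ := hG
    obtain ⟨h, rfl⟩ := hH
    exact ⟨g + h, by rw [dilate_add]; ring⟩
  | monomial n a =>
    refine ⟨monomial n (a / (κ * qpow logq (-2) ^ n - κ')), ?_⟩
    ext m
    simp only [coeff_sub, coeff_C_mul, coeff_dilate, coeff_monomial]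
    split_ifs with h
    · subst h
      have := sub_ne_zero.2 (hgen n)
      field_simp
    · simp

/-- Decompose `F = A p(xq⁻²) + B p`. With `z = p g - A/κ'` the equation reduces to a diagonal one
for `g`, provided `p(xq⁻²)` divides `κ A(xq⁻²) + κ' B`; the hypothesis on `F` says just this. -/
theorem exists_wronskian_solution {κ κ' : ℂ} (hκ' : κ' ≠ 0)
    (hgen : ∀ n : ℕ, κ * qpow logq (-2) ^ n ≠ κ') {p F : ℂ[X]}
    (hcop : IsCoprime p (dilate logq 2 p))
    (hdvd : p ∣ C κ * dilate logq 2 p * F + C κ' * dilate logq (-2) p * dilate logq 2 F) :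
    ∃ z, C κ * p * dilate logq (-2) z - C κ' * dilate logq (-2) p * z = F := by
  have hcop' : IsCoprime p (dilate logq (-2) p) := by
    have := isCoprime_dilate logq (a := -2) hcop
    rw [dilate_dilate, neg_add_cancel, dilate_zero] at this
    exact this.symm
  obtain ⟨u, v, huv⟩ := hcop'
  obtain ⟨A, hA⟩ : ∃ A, A = v * F := ⟨_, rfl⟩
  obtain ⟨B, hB⟩ : ∃ B, B = u * F := ⟨_, rfl⟩
  have hF : F = A * dilate logq (-2) p + B * p := by
    rw [hA, hB]; linear_combination (-F) * huv
  have h1 : p ∣ C κ * A + C κ' * dilate logq 2 B := by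
    have h2 : p ∣ dilate logq 2 p * dilate logq (-2) p * (C κ * A + C κ' * dilate logq 2 B) := by
      have hF2 : dilate logq 2 F = dilate logq 2 A * p + dilate logq 2 B * dilate logq 2 p := by
        rw [hF, dilate_add, dilate_mul, dilate_mul, dilate_dilate, add_neg_cancel, dilate_zero]
      obtain ⟨w, hw⟩ := hdvd
      rw [hF2] at hw
      refine ⟨w - C κ * dilate logq 2 p * B - C κ' * dilate logq (-2) p * dilate logq 2 A, ?_⟩
      linear_combination hw - C κ * dilate logq 2 p * hF
    refine (IsCoprime.mul_right hcop ⟨u, v, huv⟩).dvd_of_dvd_mul_left h2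
  obtain ⟨w, hw⟩ := dilate_dvd logq (a := -2) h1
  rw [dilate_add, dilate_mul, dilate_mul, dilate_C, dilate_C, dilate_dilate, neg_add_cancel,
    dilate_zero] at hw
  obtain ⟨g, hg⟩ := exists_dilate_sub_eq logq hgen (C κ'⁻¹ * w)
  have hk : C κ' * C κ'⁻¹ = (1 : ℂ[X]) := by rw [← C_mul, mul_inv_cancel₀ hκ', C_1]
  refine ⟨p * g - C κ'⁻¹ * A, ?_⟩
  rw [dilate_sub, dilate_mul, dilate_mul, dilate_C]
  linear_combination p * dilate logq (-2) p * hg - C κ'⁻¹ * p * hw - hF +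
    (dilate logq (-2) p * A + p * B) * hk

/-- The divisibility needed to solve the next equation is inherited from the Bethe ansatz
equation, since both differ by factors which are coprime. -/
theorem dvd_of_wronskian_eq {κ κ₁ : ℂ} (hκ₁ : κ₁ ≠ 0) {p p' z a b F : ℂ[X]}
    (hcop : IsCoprime p (dilate logq 2 p))
    (hz : C κ * p * dilate logq (-2) z - C κ₁ * dilate logq (-2) p * z =
      F * dilate logq (-2) p')
    (hdvd : p' ∣ C κ₁ * a * p + b * dilate logq 2 p) :
    p' ∣ C κ * a * z + b * dilate logq 2 z := by
  -- Modulo `p'` this says that `(κ z, z(xq²))` and `(κ₁ p, p(xq²))` are proportional. Hence `p'`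
  -- divides the target times `p` and times `p(xq²)`, which are coprime.
  have hz2 := congrArg (dilate logq 2) hz
  simp only [dilate_sub, dilate_mul, dilate_C, dilate_dilate, add_neg_cancel, dilate_zero] at hz2
  obtain ⟨w, hw⟩ := hdvd
  obtain ⟨u, v, huv⟩ := hcop
  have hk : C κ₁ * C κ₁⁻¹ = (1 : ℂ[X]) := by rw [← C_mul, mul_inv_cancel₀ hκ₁, C_1]
  refine ⟨u * C κ₁⁻¹ * (C κ * z * w - b * dilate logq 2 F) +
    v * (dilate logq 2 z * w + a * dilate logq 2 F), ?_⟩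
  linear_combination (-(C κ * a * z + b * dilate logq 2 z)) * huv -
    u * p * (C κ * a * z + b * dilate logq 2 z) * hk +
    u * C κ₁⁻¹ * (C κ * z * hw - b * hz2) + v * (dilate logq 2 z * hw + a * hz2)

end Solve

/-! ### Plücker relations and discrete Wronskians. -/

section Determinants

/-- Cramer's rule: let `m` be the vector of signed maximal minors of `A`. The entries of `B m` are
the determinants with row `B b` put on top of `A`, and the identity is the `c`-th coordinate of
`adj(B) B m = det(B) m`. -/
theorem sum_minor_mul_det_cons {R : Type*} [CommRing R] {k : ℕ}
    (A : Matrix (Fin k) (Fin (k + 1)) R) (B : Matrix (Fin (k + 1)) (Fin (k + 1)) R)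
    (c : Fin (k + 1)) :
    (A.submatrix id c.succAbove).det * B.det =
      ∑ b : Fin (k + 1), (-1) ^ (b : ℕ) * (B.submatrix b.succAbove c.succAbove).det *
        (Matrix.of (Fin.cons (B b) A : Fin (k + 1) → Fin (k + 1) → R)).det := by
  have hexp : ∀ b, (Matrix.of (Fin.cons (B b) A : Fin (k + 1) → Fin (k + 1) → R)).det =
      ∑ d : Fin (k + 1), (-1) ^ (d : ℕ) * B b d * (A.submatrix id d.succAbove).det := by
    intro b
    rw [Matrix.det_succ_row_zero]
    rfl
  have hadj : ∀ b : Fin (k + 1), (B.submatrix b.succAbove c.succAbove).det =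
      (-1) ^ ((b : ℕ) + c) * B.adjugate c b := by
    intro b
    rw [Matrix.adjugate_fin_succ_eq_det_submatrix, ← mul_assoc, ← pow_add, ← two_mul, pow_mul]
    simp
  have hmul : ∀ d : Fin (k + 1), ∑ b, B.adjugate c b * B b d = if c = d then B.det else 0 := by
    intro d
    have := congrFun (congrFun B.adjugate_mul c) d
    rw [Matrix.mul_apply] at this
    simpa [Matrix.one_apply] using this
  have hsign : ∀ n : ℕ, ((-1 : R) ^ n) * (-1) ^ n = 1 := fun n => by
    rw [← pow_add, ← two_mul, pow_mul]; simp
  calc (A.submatrix id c.succAbove).det * B.det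
      = ∑ d : Fin (k + 1), (-1) ^ ((c : ℕ) + d) * (A.submatrix id d.succAbove).det *
          ∑ b, B.adjugate c b * B b d := by
        simp only [hmul, mul_ite, mul_zero, Finset.sum_ite_eq, Finset.mem_univ, if_true]
        rw [pow_add, hsign, one_mul]
    _ = _ := by
        simp only [hexp, hadj, Finset.mul_sum]
        rw [Finset.sum_comm]
        refine Finset.sum_congr rfl fun b _ => Finset.sum_congr rfl fun d _ => ?_
        rw [pow_add, pow_add]
        linear_combination (-(-1) ^ (c : ℕ) * (-1) ^ (d : ℕ) * (A.submatrix id d.succAbove).det *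
          B.adjugate c b * B b d) * hsign b

variable (logq : ℂ)

theorem wronskian_eq_det_castSucc {k : ℕ} (g : Fin k → QuasiField) :
    wronskian logq g = ((Matrix.of fun (i : Fin k) (j : Fin (k + 1)) =>
      (tau logq)^[(j : ℕ)] (g i)).submatrix id (Fin.last k).succAbove).det := by
  rw [wronskian]
  congr 1
  ext i j
  simp

theorem tau_wronskian {k : ℕ} (g : Fin k → QuasiField) :
    tau logq (wronskian logq g) = ((Matrix.of fun (i : Fin k) (j : Fin (k + 1)) =>
      (tau logq)^[(j : ℕ)] (g i)).submatrix id (0 : Fin (k + 1)).succAbove).det := by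
  rw [wronskian, RingEquiv.map_det]
  congr 1
  ext i j
  simp [Function.iterate_succ_apply']

/-- The deleted column is the last one, so the minors are Wronskians; deleting column `0` instead
produces their images under `τ`, as in the next identity. -/
theorem wronskian_mul_wronskian {k : ℕ} (A : Fin k → QuasiField) (B : Fin (k + 1) → QuasiField) :
    wronskian logq A * wronskian logq B = ∑ b : Fin (k + 1), (-1) ^ (b : ℕ) *
      wronskian logq (fun i => B (b.succAbove i)) *
        wronskian logq (Fin.cons (B b) A : Fin (k + 1) → QuasiField) := by
  rw [wronskian_eq_det_castSucc, wronskian, sum_minor_mul_det_cons]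
  refine Finset.sum_congr rfl fun b _ => ?_
  rw [wronskian_eq_det_castSucc, wronskian]
  congr 2
  ext i j
  refine Fin.cases ?_ (fun i => ?_) i <;> rfl

theorem tau_wronskian_mul_wronskian {k : ℕ} (A : Fin k → QuasiField)
    (B : Fin (k + 1) → QuasiField) :
    tau logq (wronskian logq A) * wronskian logq B = ∑ b : Fin (k + 1), (-1) ^ (b : ℕ) *
      tau logq (wronskian logq (fun i => B (b.succAbove i))) *
        wronskian logq (Fin.cons (B b) A : Fin (k + 1) → QuasiField) := by
  rw [tau_wronskian, wronskian, sum_minor_mul_det_cons]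
  refine Finset.sum_congr rfl fun b _ => ?_
  rw [tau_wronskian, wronskian]
  congr 2
  ext i j
  refine Fin.cases ?_ (fun i => ?_) i <;> rfl

/-- Adding the combination of columns prescribed by `D` to the last column turns its entries into `D
f, 0, …, 0`. -/
theorem wronskian_cons_of_annihilated {n : ℕ} {D : QuasiField → QuasiField}
    (hD : IsMonicDifferenceOp logq n D) {g : Fin n → QuasiField} (hg : ∀ i, D (g i) = 0)
    (f : QuasiField) :
    wronskian logq (Fin.cons f g : Fin (n + 1) → QuasiField) =
      (-1) ^ n * D f * wronskian logq g := by
  obtain ⟨a, ha⟩ := hD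
  set M := Matrix.of fun i j : Fin (n + 1) =>
    (tau logq)^[(j : ℕ)] ((Fin.cons f g : Fin (n + 1) → QuasiField) i) with hM
  have h1 := Matrix.det_updateCol_sum M (Fin.last n)
    (Fin.snoc a 1 : Fin (n + 1) → QuasiField)
  have h2 : (fun k => ∑ i, (Fin.snoc a 1 : Fin (n + 1) → QuasiField) i • M k i) =
      fun k => D ((Fin.cons f g : Fin (n + 1) → QuasiField) k) := by
    funext k
    rw [ha, Fin.sum_univ_castSucc]
    simp [hM]
  rw [h2, Fin.snoc_last, one_smul] at h1
  rw [wronskian, ← hM, ← h1, Matrix.det_succ_column _ (Fin.last n), Fin.sum_univ_succ,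
    Finset.sum_eq_zero]
  · rw [add_zero, wronskian]
    simp only [Matrix.updateCol_self, Fin.cons_zero, Fin.val_zero, Fin.val_last, zero_add]
    congr 2
    ext i j
    simp [Matrix.submatrix_apply, hM, Fin.succAbove_last,
      (Fin.castSucc_lt_last j).ne]
  · intro i _
    simp [hg]

theorem isMonicDifferenceOp_firstOrderOp_mul {n : ℕ} (a : QuasiField)
    {D : AddMonoid.End QuasiField} (hD : IsMonicDifferenceOp logq n D) :
    IsMonicDifferenceOp logq (n + 1) (firstOrderOp logq a * D : AddMonoid.End QuasiField) := by
  obtain ⟨c, hc⟩ := hD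
  refine ⟨fun j => (Fin.cons 0 (fun i => tau logq (c i)) : Fin (n + 1) → QuasiField) j -
    a * (Fin.snoc c 1 : Fin (n + 1) → QuasiField) j, fun f => ?_⟩
  have h : (firstOrderOp logq a * D : AddMonoid.End QuasiField) f =
    tau logq (D f) - a * D f := rfl
  rw [h, hc]
  obtain ⟨t, ht⟩ : ∃ t : ℕ → QuasiField, ∀ j, (tau logq)^[j] f = t j := ⟨_, fun _ => rfl⟩
  have hs : ∀ j, tau logq (t j) = t (j + 1) := fun j => by
    rw [← ht, ← ht, Function.iterate_succ_apply']
  simp only [ht, sub_mul, Finset.sum_sub_distrib]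
  have h1 : ∑ j : Fin (n + 1), (Fin.cons 0 (fun i => tau logq (c i)) : Fin (n + 1) → QuasiField) j
      * t j = ∑ j : Fin n, tau logq (c j) * t (j + 1) := by
    rw [Fin.sum_univ_succ]
    simp
  have h2 : ∑ j : Fin (n + 1), a * (Fin.snoc c 1 : Fin (n + 1) → QuasiField) j * t j =
      a * (∑ j : Fin n, c j * t j + t n) := by
    rw [Fin.sum_univ_castSucc, mul_add, Finset.mul_sum]
    simp [mul_assoc]
  rw [h1, h2, map_add, map_sum]
  simp only [map_mul, hs]
  exact add_sub_right_comm _ _ _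

end Determinants

/-! ### Recursions for the frame polynomials `Q_k`. -/

section Frames

variable {N : ℕ} (logq : ℂ) (T : Fin (N - 1) → ℂ[X])

/-- `∏_{j=i}^{N-1} T_j(x * q ^ (2 (i - j)))`. -/
def frameFactor (i : ℕ) : ℂ[X] :=
  ∏ j ∈ Finset.Icc i (N - 1), dilate logq (2 * ((i : ℂ) - j)) (entry 1 T j)

theorem entry_withOne (k : ℕ) : entry 1 (withOne T) k = entry 1 T k := by
  unfold withOne entry
  by_cases h : 1 ≤ k ∧ k ≤ N
  · have : k - 1 + 1 = k := by omega
    rw [dif_pos h]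
    simp only [this]
  · rw [dif_neg h, dif_neg (by omega)]

theorem entry_one_eq_one {k : ℕ} (hk : N ≤ k) (hN : 1 ≤ N) : entry 1 T k = 1 :=
  dif_neg (by omega)

theorem frameFactor_of_le {i : ℕ} (hN : 1 ≤ N) (hi : N ≤ i) : frameFactor logq T i = 1 := by
  rw [frameFactor, Finset.Icc_eq_empty (by omega), Finset.prod_empty]

theorem frameFactor_eq {i : ℕ} (hi : i ≤ N - 1) :
    frameFactor logq T i = entry 1 T i * dilate logq (-2) (frameFactor logq T (i + 1)) := by
  rw [frameFactor, ← Finset.insert_Icc_succ_left_eq_Icc hi,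
    Finset.prod_insert (by simp), sub_self, mul_zero, dilate_zero, frameFactor, dilate_prod]
  congr 1
  refine Finset.prod_congr rfl fun j _ => ?_
  rw [dilate_dilate]
  congr 1
  simp
  ring

/-- The new factors are those with the largest `j`, namely `j = k + 1 - i`; the substitution `i ↦ N
- i + 1` makes them a frame factor, where the extra index `N` contributes `1`. -/
theorem frameProd_succ {k : ℕ} (hk : k + 1 ≤ N) : frameProd logq (withOne T) (k + 1) =
    frameProd logq (withOne T) k * frameFactor logq T (N - k) := by
  unfold frameProd
  have h1 : ∀ i ∈ Finset.Icc 1 (k + 1),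
      ∏ j ∈ Finset.range (k + 1 - i + 1),
        dilate logq (-2 * j) (entry 1 (withOne T) (N - i + 1)) =
      (∏ j ∈ Finset.range (k + 1 - i),
        dilate logq (-2 * j) (entry 1 (withOne T) (N - i + 1))) *
      dilate logq (-2 * (k + 1 - i : ℕ)) (entry 1 (withOne T) (N - i + 1)) := fun i _ =>
    Finset.prod_range_succ ..
  rw [Finset.prod_congr rfl h1, Finset.prod_mul_distrib]
  congr 1
  · rw [Finset.prod_Icc_succ_top (by omega), Nat.sub_self, Finset.prod_range_zero, mul_one]
    refine Finset.prod_congr rfl fun i hi => ?_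
    rw [Finset.mem_Icc] at hi
    rw [show k + 1 - i = k - i + 1 by omega]
  · have h2 : frameFactor logq T (N - k) = ∏ j ∈ Finset.Icc (N - k) N,
        dilate logq (2 * (((N - k : ℕ) : ℂ) - j)) (entry 1 T j) := by
      rw [frameFactor]
      refine Finset.prod_subset (Finset.Icc_subset_Icc_right (by omega)) fun j hj hj' => ?_
      rw [Finset.mem_Icc] at hj hj'
      rw [entry_one_eq_one T (by omega) (by omega), dilate_one]
    rw [h2]
    refine Finset.prod_nbij' (fun i => N - i + 1) (fun j => N - j + 1) ?_ ?_ ?_ ?_ ?_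
    · intro i hi
      rw [Finset.mem_Icc] at *
      omega
    · intro i hi
      rw [Finset.mem_Icc] at *
      omega
    · intro i hi
      rw [Finset.mem_Icc] at hi
      omega
    · intro i hi
      rw [Finset.mem_Icc] at hi
      omega
    · intro i hi
      rw [Finset.mem_Icc] at hi
      rw [entry_withOne]
      congr 1
      push_cast [show k ≤ N by omega, show i ≤ k + 1 by omega, show i ≤ N by omega]
      ring

theorem frameProd_zero (T : Fin N → ℂ[X]) : frameProd logq T 0 = 1 := by simp [frameProd]

variable {T}

theorem entry_one_monic (hT : ∀ i, (T i).Monic) (k : ℕ) : (entry 1 T k).Monic := by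
  unfold entry
  split_ifs
  · exact hT _
  · exact monic_one

theorem frameFactor_ne_zero (hT : ∀ i, (T i).Monic) (i : ℕ) : frameFactor logq T i ≠ 0 :=
  Finset.prod_ne_zero_iff.2 fun _ _ => dilate_ne_zero _ (entry_one_monic hT _).ne_zero

theorem frameProd_ne_zero (hT : ∀ i, (T i).Monic) (k : ℕ) :
    frameProd logq (withOne T) k ≠ 0 :=
  Finset.prod_ne_zero_iff.2 fun _ _ => Finset.prod_ne_zero_iff.2 fun _ _ =>
    dilate_ne_zero _ (by rw [entry_withOne]; exact (entry_one_monic hT _).ne_zero)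

end Frames

/-! ### Consequences of regularity and admissibility; the chain of polynomials. -/

section Points

variable {N : ℕ} {logq : ℂ} {lam : Fin N → ℂ} {T : Fin (N - 1) → ℂ[X]} {l : Fin (N - 1) → ℕ}
  {t : Point l}

theorem pPoly_succ (t : Point l) (i : Fin (N - 1)) :
    pPoly t (i + 1) = ∏ j : Fin (l i), (X - C (t i j)) := by
  rw [pPoly, coordProd, dif_pos ⟨by omega, by omega⟩]
  rfl

theorem pPoly_eq_one (t : Point l) {k : ℕ} (hk : ¬(1 ≤ k ∧ k ≤ N - 1)) : pPoly t k = 1 :=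
  dif_neg hk

theorem pPoly_ne_zero (t : Point l) (k : ℕ) : pPoly t k ≠ 0 := by
  unfold pPoly coordProd
  split_ifs
  · exact Finset.prod_ne_zero_iff.2 fun _ _ => X_sub_C_ne_zero _
  · exact one_ne_zero

/-- Admissibility says that no root of `p_k` is a root of `p_k(xq²)`. -/
theorem isCoprime_pPoly (hadm : IsAdmissible logq t) (k : ℕ) :
    IsCoprime (pPoly t k) (dilate logq 2 (pPoly t k)) := by
  unfold pPoly coordProd
  split_ifs with h
  · rw [dilate_prod]
    refine IsCoprime.prod_left fun j _ => IsCoprime.prod_right fun m _ => ?_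
    have h1 := sub_ne_zero.2 (hadm ⟨k - 1, by omega⟩ m j)
    set a := t ⟨k - 1, by omega⟩ j
    set b := t ⟨k - 1, by omega⟩ m
    have h2 : C (b - a * qpow logq 2)⁻¹ * (C b - C a * C (qpow logq 2)) = 1 := by
      rw [← C_mul, ← C_sub, ← C_mul, inv_mul_cancel₀ h1, C_1]
    -- Bézout: `q²(X - a) - (q²X - b) = b - a q²`, a nonzero constant.
    refine ⟨C (b - a * qpow logq 2)⁻¹ * C (qpow logq 2), - C (b - a * qpow logq 2)⁻¹, ?_⟩
    simp only [dilate, sub_comp, X_comp, C_comp]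
    linear_combination h2
  · exact isCoprime_one_left

/-- Regularity, applied to the full set of indices with value `a`, bounds the multiplicity of `a` in
`P_i` from below by that in `p_i`. -/
theorem pPoly_dvd_bethePoly (ht : IsRegularSolution logq lam T t) (i : Fin (N - 1)) :
    pPoly t (i + 1) ∣ bethePoly logq lam T t (i + 1) := by
  by_cases h0 : bethePoly logq lam T t (i + 1) = 0
  · rw [h0]
    exact dvd_zero _
  rw [pPoly_succ]
  have hprod : ∏ j : Fin (l i), (X - C (t i j)) =
      ((Multiset.map (t i) Finset.univ.val).map fun a => X - C a).prod := by
    rw [Multiset.map_map]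
    rfl
  rw [hprod, Multiset.prod_X_sub_C_dvd_iff_le_roots h0, Multiset.le_iff_count]
  intro a
  rw [count_roots, Multiset.count_map]
  set I := Finset.univ.filter fun j => a = t i j with hI
  change I.card ≤ _
  by_contra hlt
  rw [not_le] at hlt
  have := (lt_rootMultiplicity_iff_isRoot_iterate_derivative h0 (t := a)
    (n := rootMultiplicity a (bethePoly logq lam T t (i + 1)))).2 fun m hm =>
      ht.2 i I a (fun j hj => ((Finset.mem_filter.1 hj).2).symm) m (by omega)
  exact lt_irrefl _ this

theorem exists_seq_of_step {α : Type*} (P : ℕ → α → Prop) (R : ℕ → α → α → Prop) (a : ℕ)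
    (x : α) (h0 : P a x) (h : ∀ i x, a ≤ i → P i x → ∃ y, R i x y ∧ P (i + 1) y) :
    ∃ z : ℕ → α, z a = x ∧ ∀ i, a ≤ i → R i (z i) (z (i + 1)) := by
  choose! f hf using h
  let g : ℕ → α := fun n => Nat.rec x (fun m y => f (a + m) y) n
  have hg : ∀ n, P (a + n) (g n) := by
    intro n
    induction n with
    | zero => exact h0
    | succ n ih => exact (hf _ _ (by omega) ih).2
  refine ⟨fun i => g (i - a), by simp [g], fun i hi => ?_⟩
  obtain ⟨n, rfl⟩ := Nat.exists_eq_add_of_le hi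
  have := (hf _ _ (by omega) (hg n)).1
  simp only [Nat.add_sub_cancel_left, show a + n + 1 - a = n + 1 by omega]
  exact this

/-- `q ^ (-2 λ_k)`. -/
def eigenvalue (logq : ℂ) (lam : Fin N → ℂ) (k : ℕ) : ℂ := qpow logq (-2 * entry 0 lam k)

theorem eigenvalue_ne_zero (k : ℕ) : eigenvalue logq lam k ≠ 0 := qpow_ne_zero _ _

theorem eigenvalue_succ (i : Fin N) : eigenvalue logq lam (i + 1) = qpow logq (-2 * lam i) := by
  rw [eigenvalue, entry, dif_pos ⟨by omega, by omega⟩]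
  rfl

theorem qpow_pow (a : ℂ) (n : ℕ) : qpow logq a ^ n = qpow logq (a * n) := by
  rw [qpow, ← Complex.exp_nat_mul, qpow]
  ring_nf

/-- This is the form in which genericity is used: the spectra of `τ` on types `λ_i` and `λ_j` are
disjoint. -/
theorem eigenvalue_mul_pow_ne (hlam : IsGenericWeight logq lam) {i j : Fin N} (hij : i ≠ j)
    (m n : ℕ) : eigenvalue logq lam (i + 1) * qpow logq (-2) ^ m ≠
      eigenvalue logq lam (j + 1) * qpow logq (-2) ^ n := by
  rw [eigenvalue_succ, eigenvalue_succ]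
  have key : ∀ {a b : ℂ} {m n : ℕ}, qpow logq (-2 * a) * qpow logq (-2) ^ m =
      qpow logq (-2 * b) * qpow logq (-2) ^ n →
      qpow logq (2 * (a - b)) = qpow logq (2 * ((n - m : ℤ) : ℂ)) := by
    intro a b m n h
    rw [qpow_pow, qpow_pow, ← qpow_add, ← qpow_add] at h
    have h' := congrArg (fun y => y * qpow logq (2 * a + 2 * n)) h
    simp only [← qpow_add] at h'
    convert h'.symm using 2
    · ring
    · push_cast
      ring
  intro h
  rcases lt_or_gt_of_ne hij with hlt | hlt
  · exact hlam i j hlt _ (key h)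
  · exact hlam j i hlt _ (key h.symm)

variable (logq lam) in
/-- `p_i` divides `P_i`, in terms of the numbers `q ^ (-2 λ_k)`. -/
theorem dvd_bethe (ht : IsRegularSolution logq lam T t) (i : ℕ) (hi : 1 ≤ i) (hi' : i ≤ N - 1) :
    pPoly t i ∣ C (eigenvalue logq lam i) *
        (dilate logq 2 (pPoly t i) * entry 1 T i * dilate logq (-2) (pPoly t (i + 1))) *
          pPoly t (i - 1) +
      (C (eigenvalue logq lam (i + 1)) * dilate logq (-2) (pPoly t i) *
        dilate logq 2 (entry 1 T i) * pPoly t (i + 1)) * dilate logq 2 (pPoly t (i - 1)) := by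
  have h := pPoly_dvd_bethePoly ht ⟨i - 1, by omega⟩
  simp only [Nat.sub_add_cancel hi] at h
  refine (h.mul_left (C (eigenvalue logq lam i) * C (eigenvalue logq lam (i + 1)))).trans ?_
  have e : ∀ k, C (eigenvalue logq lam k) * C (qpow logq (2 * entry 0 lam k)) = 1 := by
    intro k
    rw [eigenvalue, ← C_mul, neg_mul, qpow_neg_mul, C_1]
  refine dvd_of_eq ?_
  rw [bethePoly]
  linear_combination
    (C (eigenvalue logq lam i) * dilate logq 2 (pPoly t i) * pPoly t (i - 1) *
      dilate logq (-2) (pPoly t (i + 1)) * entry 1 T i) * e (i + 1) +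
    (C (eigenvalue logq lam (i + 1)) * dilate logq (-2) (pPoly t i) *
      dilate logq 2 (pPoly t (i - 1)) * pPoly t (i + 1) * dilate logq 2 (entry 1 T i)) * e i

/-- The polynomial `z i` plays the role of `p_{i-1}`: the invariant carried along is the
divisibility of `dvd_bethe` with `p_{i-1}` replaced by `z i` and `q^{-2λ_i}` by the eigenvalue of
`b`. -/
theorem exists_chain (hlam : IsGenericWeight logq lam) (ht : IsRegularSolution logq lam T t)
    (hadm : IsAdmissible logq t) (b : Fin N) :
    ∃ z : ℕ → ℂ[X], z (b + 1) = pPoly t b ∧ ∀ i, (b : ℕ) + 1 ≤ i → i ≤ N - 1 →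
      C (eigenvalue logq lam (b + 1)) * pPoly t i * dilate logq (-2) (z (i + 1)) -
        C (eigenvalue logq lam (i + 1)) * dilate logq (-2) (pPoly t i) * z (i + 1) =
      z i * entry 1 T i * dilate logq (-2) (pPoly t (i + 1)) := by
  refine exists_seq_of_step
    (fun i z => i ≤ N - 1 → pPoly t i ∣ C (eigenvalue logq lam (b + 1)) *
        (dilate logq 2 (pPoly t i) * entry 1 T i * dilate logq (-2) (pPoly t (i + 1))) * z +
      (C (eigenvalue logq lam (i + 1)) * dilate logq (-2) (pPoly t i) *
        dilate logq 2 (entry 1 T i) * pPoly t (i + 1)) * dilate logq 2 z)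
    (fun i z w => i ≤ N - 1 →
      C (eigenvalue logq lam (b + 1)) * pPoly t i * dilate logq (-2) w -
        C (eigenvalue logq lam (i + 1)) * dilate logq (-2) (pPoly t i) * w =
      z * entry 1 T i * dilate logq (-2) (pPoly t (i + 1))) (b + 1) (pPoly t b)
    (fun hb => dvd_bethe logq lam ht (b + 1) (by omega) hb) ?_
  intro i z hi hz
  by_cases hiN : i ≤ N - 1
  swap
  -- Beyond `N - 1` nothing is required, so the value is arbitrary.
  · exact ⟨0, fun h => absurd h hiN, fun h => absurd h (by omega)⟩
  have hgen : ∀ n : ℕ, eigenvalue logq lam (b + 1) * qpow logq (-2) ^ n ≠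
      eigenvalue logq lam (i + 1) := by
    intro n
    have := eigenvalue_mul_pow_ne hlam (i := b) (j := ⟨i, by omega⟩)
      (fun h => by simp [h] at hi) n 0
    rwa [pow_zero, mul_one] at this
  obtain ⟨w, hw⟩ := exists_wronskian_solution logq (eigenvalue_ne_zero (i + 1)) hgen
    (isCoprime_pPoly hadm i) (F := z * entry 1 T i * dilate logq (-2) (pPoly t (i + 1))) (by
      convert hz hiN using 1
      simp only [dilate_mul, dilate_dilate, add_neg_cancel, dilate_zero]
      ring)
  refine ⟨w, fun _ => hw, fun hi1 => ?_⟩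
  exact dvd_of_wronskian_eq logq (eigenvalue_ne_zero (i + 1)) (isCoprime_pPoly hadm i) hw
    (dvd_bethe logq lam ht (i + 1) (by omega) hi1)

end Points

/-! ### Right factors of `D^t` and their action on each `u_b`. -/

section Factorization

variable {N : ℕ} {logq : ℂ} {lam : Fin N → ℂ} {T : Fin (N - 1) → ℂ[X]} {l : Fin (N - 1) → ℕ}
  {t : Point l}

/-- `f(x) = x ^ α * P(x, log x) / Q(x)`. -/
def IsRationalQuasi (α : ℂ) (f : QuasiField) : Prop :=
  ∃ (P : ℂ[X][X]) (Q : ℂ[X]), Q ≠ 0 ∧ f = xpow α * evalLog P / ofPoly Q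

theorem IsRationalQuasi.sub {α : ℂ} {f g : QuasiField} (hf : IsRationalQuasi α f)
    (hg : IsRationalQuasi α g) : IsRationalQuasi α (f - g) := by
  obtain ⟨P, Q, hQ, rfl⟩ := hf
  obtain ⟨P', Q', hQ', rfl⟩ := hg
  refine ⟨P * C Q' - P' * C Q, Q * Q', mul_ne_zero hQ hQ', ?_⟩
  have h1 := ofPoly_ne_zero hQ
  have h2 := ofPoly_ne_zero hQ'
  simp only [map_sub, map_mul, evalLog_C]
  field_simp

theorem IsRationalQuasi.apply_tau {α : ℂ} {f : QuasiField} (hf : IsRationalQuasi α f) :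
    IsRationalQuasi α (tau logq f) := by
  obtain ⟨P, Q, hQ, rfl⟩ := hf
  refine ⟨C (C (qpow logq (-2 * α))) * shiftPoly logq P, dilate logq (-2) Q,
    dilate_ne_zero logq hQ, ?_⟩
  rw [map_div₀, map_mul, tau_xpow, tau_evalLog, tau_ofPoly, map_mul, evalLog_C]
  ring

theorem IsRationalQuasi.mul_ofPoly_div {α : ℂ} {f : QuasiField} (hf : IsRationalQuasi α f)
    (A : ℂ[X]) {B : ℂ[X]} (hB : B ≠ 0) : IsRationalQuasi α (ofPoly A / ofPoly B * f) := by
  obtain ⟨P, Q, hQ, rfl⟩ := hf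
  refine ⟨C A * P, B * Q, mul_ne_zero hB hQ, ?_⟩
  have h1 := ofPoly_ne_zero hQ
  have h2 := ofPoly_ne_zero hB
  simp only [map_mul, evalLog_C]
  field_simp

/-- Removing the power `x^α` multiplies the eigenvalue by a constant and reduces the question to
`eigen_shiftPoly`. -/
theorem IsRationalQuasi.eigen {α κ : ℂ} {f : QuasiField} (hlogq : logq ≠ 0)
    (hq : Function.Injective fun n : ℕ => qpow logq (-2) ^ n) (hκ : κ ≠ 0)
    (hf : IsRationalQuasi α f) (hf0 : f ≠ 0) (h : tau logq f = ofPoly (C κ) * f) :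
    (∃ m n : ℕ, qpow logq (-2 * α) * qpow logq (-2) ^ m = κ * qpow logq (-2) ^ n) ∧
      (κ = qpow logq (-2 * α) → ∃ c, f = xpow α * ofPoly (C c)) := by
  obtain ⟨P, Q, hQ, rfl⟩ := hf
  have h1 := ofPoly_ne_zero hQ
  have h2 := ofPoly_ne_zero (dilate_ne_zero logq (a := -2) hQ)
  have h3 := xpow_ne_zero α
  have hP : P ≠ 0 := by
    rintro rfl
    simp at hf0
  have hk : ofPoly (C κ⁻¹) * ofPoly (C κ) = 1 := by
    rw [← map_mul, ← C_mul, inv_mul_cancel₀ hκ, C_1, map_one]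
  have key : C (C (κ⁻¹ * qpow logq (-2 * α))) * shiftPoly logq P * C Q =
      C (dilate logq (-2) Q) * P := by
    apply evalLog_injective
    rw [map_div₀, map_mul, tau_xpow, tau_evalLog, tau_ofPoly] at h
    simp only [map_mul, evalLog_C, neg_mul]
    field_simp at h
    linear_combination ofPoly (C κ⁻¹) * h + ofPoly (dilate logq (-2) Q) * evalLog P * hk
  obtain ⟨⟨m, n, hmn⟩, hc⟩ := eigen_shiftPoly hq hlogq hP hQ key
  refine ⟨⟨m, n, ?_⟩, fun hκα => ?_⟩
  · rw [mul_assoc, inv_mul_eq_iff_eq_mul₀ hκ] at hmn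
    exact hmn
  · obtain ⟨c, rfl⟩ := hc (by rw [← hκα, inv_mul_cancel₀ hκ])
    refine ⟨c, ?_⟩
    rw [evalLog_C, map_mul]
    field_simp

theorem End_mul_apply (A B : AddMonoid.End QuasiField) (f : QuasiField) :
    (A * B) f = A (B f) := rfl

variable (logq lam T t) in
/-- The `i`-th factor of `D^t` (counted from zero). -/
def factorOp (i : Fin N) : AddMonoid.End QuasiField :=
  firstOrderOp logq (ofPoly (C (qpow logq (-2 * lam i))) *
    (tau logq (pointRatio logq T t (i + 1)) / pointRatio logq T t (i + 1)))

variable (logq lam T t) in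
/-- The product of all but the first `i` factors of `D^t`. -/
def tailOp (i : ℕ) : AddMonoid.End QuasiField :=
  (((List.finRange N).map (factorOp logq lam T t)).drop i).prod

theorem tailOp_self (f : QuasiField) : tailOp logq lam T t N f = f := by
  rw [tailOp, List.drop_eq_nil_of_le (by simp)]
  rfl

theorem tailOp_eq (i : Fin N) :
    tailOp logq lam T t i = factorOp logq lam T t i * tailOp logq lam T t (i + 1) := by
  rw [tailOp, List.drop_eq_getElem_cons (by simp), List.prod_cons, tailOp]
  simp

theorem tailOp_apply (i : Fin N) (f : QuasiField) :
    tailOp logq lam T t i f = factorOp logq lam T t i (tailOp logq lam T t (i + 1) f) := by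
  rw [tailOp_eq, End_mul_apply]

theorem isMonicDifferenceOp_tailOp {i k : ℕ} (h : i + k = N) :
    IsMonicDifferenceOp logq k (tailOp logq lam T t i) := by
  induction k generalizing i with
  | zero =>
    obtain rfl : i = N := by omega
    exact ⟨Fin.elim0, fun f => by simp [tailOp_self]⟩
  | succ k ih =>
    have := tailOp_eq (logq := logq) (lam := lam) (T := T) (t := t) ⟨i, by omega⟩
    simp only at this
    rw [this]
    exact isMonicDifferenceOp_firstOrderOp_mul logq _ (ih (by omega))

theorem pointRatio_ne_zero (hT : ∀ i, (T i).Monic) (i : ℕ) : pointRatio logq T t i ≠ 0 :=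
  mul_ne_zero (div_ne_zero (ofPoly_ne_zero (pPoly_ne_zero t _))
    (ofPoly_ne_zero (pPoly_ne_zero t _))) (ofPoly_ne_zero (frameFactor_ne_zero logq hT i))

theorem pointRatio_eq (i : ℕ) : pointRatio logq T t i =
    ofPoly (pPoly t (i - 1) * frameFactor logq T i) / ofPoly (pPoly t i) := by
  rw [pointRatio, map_mul, frameFactor]
  ring

theorem factorOp_apply (i : Fin N) (f : QuasiField) :
    factorOp logq lam T t i f = tau logq f - ofPoly (C (eigenvalue logq lam (i + 1))) *
      (tau logq (pointRatio logq T t (i + 1)) / pointRatio logq T t (i + 1)) * f := by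
  rw [eigenvalue_succ]
  rfl

theorem tailOp_C_mul {i k : ℕ} (h : i + k = N) (c : ℂ) (f : QuasiField) :
    tailOp logq lam T t i (ofPoly (C c) * f) = ofPoly (C c) * tailOp logq lam T t i f := by
  induction k generalizing i with
  | zero =>
    obtain rfl : i = N := by omega
    simp only [tailOp_self]
  | succ k ih =>
    have h1 := tailOp_apply (logq := logq) (lam := lam) (T := T) (t := t) ⟨i, by omega⟩
    simp only at h1
    rw [h1, h1, ih (by omega), factorOp_apply, factorOp_apply, map_mul, tau_ofPoly, dilate_C]
    ring

theorem IsRationalQuasi.apply_tailOp {α : ℂ} {f : QuasiField} (hT : ∀ i, (T i).Monic)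
    (hf : IsRationalQuasi α f) {i k : ℕ} (h : i + k = N) :
    IsRationalQuasi α (tailOp logq lam T t i f) := by
  induction k generalizing i with
  | zero =>
    obtain rfl : i = N := by omega
    rwa [tailOp_self]
  | succ k ih =>
    have h1 := tailOp_apply (logq := logq) (lam := lam) (T := T) (t := t) ⟨i, by omega⟩
    simp only at h1
    rw [h1, factorOp_apply]
    have h2 := ih (i := i + 1) (by omega)
    refine h2.apply_tau.sub ?_
    have e1 := ofPoly_ne_zero (pPoly_ne_zero t (i + 1))
    have e2 := ofPoly_ne_zero (dilate_ne_zero logq (a := -2) (pPoly_ne_zero t (i + 1)))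
    have e3 := ofPoly_ne_zero (mul_ne_zero (pPoly_ne_zero t (i + 1 - 1))
      (frameFactor_ne_zero logq hT (i + 1)))
    have e4 : ofPoly (C (eigenvalue logq lam (i + 1))) *
        (tau logq (pointRatio logq T t (i + 1)) / pointRatio logq T t (i + 1)) =
        ofPoly (C (eigenvalue logq lam (i + 1)) * dilate logq (-2)
          (pPoly t (i + 1 - 1) * frameFactor logq T (i + 1)) * pPoly t (i + 1)) /
        ofPoly (dilate logq (-2) (pPoly t (i + 1)) *
          (pPoly t (i + 1 - 1) * frameFactor logq T (i + 1))) := by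
      rw [pointRatio_eq, map_div₀, tau_ofPoly, tau_ofPoly, map_mul ofPoly _ (pPoly t (i + 1)),
        map_mul ofPoly (C _), map_mul ofPoly (dilate logq (-2) (pPoly t (i + 1)))]
      field_simp
    rw [e4]
    exact h2.mul_ofPoly_div _ (mul_ne_zero (dilate_ne_zero logq (pPoly_ne_zero t (i + 1)))
      (mul_ne_zero (pPoly_ne_zero t _) (frameFactor_ne_zero logq hT _)))

/-- The kernel of `τ - q^{-2λ_i} R_i(xq⁻²)/R_i(x)` on quasi-polynomials of type `λ_b`. -/
theorem kernel_factorOp (hlogq : logq ≠ 0)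
    (hq : Function.Injective fun n : ℕ => qpow logq (-2) ^ n)
    (hlam : IsGenericWeight logq lam) (hT : ∀ i, (T i).Monic) {i b : Fin N} {f : QuasiField}
    (hf : IsRationalQuasi (lam b) f) (h : factorOp logq lam T t i f = 0) :
    (i ≠ b → f = 0) ∧
      (i = b → ∃ c, f = ofPoly (C c) * (xpow (lam b) * pointRatio logq T t (b + 1))) := by
  have hR := pointRatio_ne_zero (logq := logq) (t := t) hT (i + 1)
  have hτR : tau logq (pointRatio logq T t (i + 1)) ≠ 0 :=
    (map_ne_zero_iff _ (tau logq).injective).2 hR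
  have e1 := ofPoly_ne_zero (pPoly_ne_zero t (i + 1))
  have e3 := ofPoly_ne_zero (mul_ne_zero (pPoly_ne_zero t i)
      (frameFactor_ne_zero logq hT (i + 1)))
  have hg : IsRationalQuasi (lam b) (f / pointRatio logq T t (i + 1)) := by
    have := hf.mul_ofPoly_div (pPoly t (i + 1)) (mul_ne_zero (pPoly_ne_zero t i)
      (frameFactor_ne_zero logq hT (i + 1)))
    convert this using 1
    rw [pointRatio_eq, Nat.add_sub_cancel]
    field_simp
  -- Dividing by `R` makes the kernel equation an eigenvalue equation for `τ`.
  have hτ : tau logq (f / pointRatio logq T t (i + 1)) =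
      ofPoly (C (eigenvalue logq lam (i + 1))) * (f / pointRatio logq T t (i + 1)) := by
    rw [factorOp_apply, sub_eq_zero] at h
    rw [map_div₀, h]
    field_simp
  refine ⟨fun hib => ?_, ?_⟩
  · by_contra hf0
    obtain ⟨⟨m, n, hmn⟩, -⟩ := hg.eigen hlogq hq (eigenvalue_ne_zero _) (div_ne_zero hf0 hR) hτ
    rw [← eigenvalue_succ] at hmn
    exact eigenvalue_mul_pow_ne hlam hib.symm m n hmn
  · rintro rfl
    by_cases hf0 : f = 0
    · exact ⟨0, by simp [hf0]⟩
    obtain ⟨-, hc⟩ := hg.eigen hlogq hq (eigenvalue_ne_zero _) (div_ne_zero hf0 hR) hτ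
    obtain ⟨c, hc⟩ := hc (eigenvalue_succ i)
    refine ⟨c, ?_⟩
    rw [div_eq_iff hR] at hc
    rw [hc]
    ring

/-- Since the image under `tailOp (i + 1)` is `x^{λ_b} (z_{i+1}/p_i) R_{i+1}`, the next factor
applied to it is the chain equation divided by `p_i(x) p_i(xq⁻²)`, times `x^{λ_b} R_{i+1}(xq⁻²)`. -/
theorem tailOp_chain (hT : ∀ i, (T i).Monic) {b : Fin N} {z : ℕ → ℂ[X]}
    (hz : ∀ i, (b : ℕ) + 1 ≤ i → i ≤ N - 1 →
      C (eigenvalue logq lam (b + 1)) * pPoly t i * dilate logq (-2) (z (i + 1)) -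
        C (eigenvalue logq lam (i + 1)) * dilate logq (-2) (pPoly t i) * z (i + 1) =
      z i * entry 1 T i * dilate logq (-2) (pPoly t (i + 1)))
    {i k : ℕ} (h : i + k = N) (hi : (b : ℕ) + 1 ≤ i) :
    tailOp logq lam T t i (xpow (lam b) * ofPoly (z N)) =
      xpow (lam b) * ofPoly (z i * frameFactor logq T i) / ofPoly (pPoly t i) := by
  induction k generalizing i with
  | zero =>
    obtain rfl : i = N := by omega
    rw [tailOp_self, frameFactor_of_le logq T (by omega) le_rfl, pPoly_eq_one t (by omega),
      map_one, div_one, mul_one]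
  | succ k ih =>
    have h1 := tailOp_apply (logq := logq) (lam := lam) (T := T) (t := t) ⟨i, by omega⟩
    simp only at h1
    rw [h1, ih (by omega) (by omega), factorOp_apply, pointRatio_eq, frameFactor_eq logq T
      (show i ≤ N - 1 by omega)]
    have h2 := congrArg ofPoly (hz i hi (by omega))
    have e1 := ofPoly_ne_zero (pPoly_ne_zero t (i + 1))
    have e2 := ofPoly_ne_zero (dilate_ne_zero logq (a := -2) (pPoly_ne_zero t (i + 1)))
    have e3 := ofPoly_ne_zero (pPoly_ne_zero t i)
    have e4 := ofPoly_ne_zero (frameFactor_ne_zero logq hT (i + 1))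
    simp only [Nat.add_sub_cancel, map_div₀, tau_ofPoly, map_mul, map_sub,
      tau_xpow] at h2 ⊢
    rw [← eigenvalue_succ]
    field_simp
    linear_combination (xpow (lam b) *
      ofPoly (dilate logq (-2) (frameFactor logq T (i + 1)))) * h2

/-- Up to a factor, `u_b` is obtained from the chain of polynomials of `exists_chain`. -/
theorem exists_tailOp_apply_eq (hlogq : logq ≠ 0)
    (hq : Function.Injective fun n : ℕ => qpow logq (-2) ^ n)
    (hlam : IsGenericWeight logq lam) (hT : ∀ i, (T i).Monic)
    (ht : IsRegularSolution logq lam T t) (hadm : IsAdmissible logq t) (b : Fin N)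
    {u : QuasiField} (hu : IsQuasiPoly (lam b) u) (hu0 : u ≠ 0)
    (hD : pointOp logq lam T t u = 0) :
    (∀ i ≤ (b : ℕ), tailOp logq lam T t i u = 0) ∧
    ∃ (z : ℕ → ℂ[X]) (c : ℂ), c ≠ 0 ∧ z (b + 1) = C c * pPoly t b ∧
      ∀ i, (b : ℕ) + 1 ≤ i → i ≤ N → tailOp logq lam T t i u =
        xpow (lam b) * ofPoly (z i * frameFactor logq T i) / ofPoly (pPoly t i) := by
  have hB : IsRationalQuasi (lam b) u := by
    obtain ⟨p, rfl⟩ := hu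
    exact ⟨p, 1, one_ne_zero, by simp⟩
  -- Factors with index below `b` are injective on rational quasi-polynomials of type `λ_b`, so they
  -- can be stripped from the left.
  have hlow : ∀ i ≤ (b : ℕ), tailOp logq lam T t i u = 0 := by
    intro i
    induction i with
    | zero => exact fun _ => hD
    | succ i ih =>
      intro hi
      have h1 := ih (by omega)
      have h2 := tailOp_apply (logq := logq) (lam := lam) (T := T) (t := t) ⟨i, by omega⟩ u
      simp only at h2
      rw [h2] at h1
      exact (kernel_factorOp hlogq hq hlam hT
        (hB.apply_tailOp hT (show i + 1 + (N - (i + 1)) = N by omega)) h1).1 fun h => by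
          simp [← h] at hi
  refine ⟨hlow, ?_⟩
  obtain ⟨z, hzb, hz⟩ := exists_chain hlam ht hadm b
  have hchain := fun i => tailOp_chain (lam := lam) (logq := logq) (t := t) hT hz (i := i)
    (k := N - i)
  have hb := hlow b le_rfl
  rw [tailOp_apply] at hb
  obtain ⟨c, hc⟩ := (kernel_factorOp hlogq hq hlam hT
    (hB.apply_tailOp hT (show (b : ℕ) + 1 + (N - (b + 1)) = N by omega)) hb).2 rfl
  -- The difference is killed by `tailOp (b + 1)`; the factors after the `b`-th are again injective
  -- on this type, so stripping them leaves the difference itself equal to zero.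
  have hcu : u = ofPoly (C c) * (xpow (lam b) * ofPoly (z N)) := by
    rw [← sub_eq_zero]
    set v := u - ofPoly (C c) * (xpow (lam b) * ofPoly (z N)) with hv
    have hvB : IsRationalQuasi (lam b) v :=
      hB.sub ⟨C (C c * z N), 1, one_ne_zero, by rw [evalLog_C, map_mul, map_one]; ring⟩
    suffices h : ∀ i, (b : ℕ) + 1 ≤ i → i ≤ N → tailOp logq lam T t i v = 0 by
      have := h N (by omega) le_rfl
      rwa [tailOp_self] at this
    intro i hi
    induction i, hi using Nat.le_induction with
    | base =>
      intro _
      rw [hv, map_sub, tailOp_C_mul (show (b : ℕ) + 1 + (N - (b + 1)) = N by omega), hc,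
        hchain (b + 1) (by omega) le_rfl, hzb, pointRatio_eq, Nat.add_sub_cancel]
      ring
    | succ i hi ih =>
      intro hiN
      have h1 := ih (by omega)
      have h2 := tailOp_apply (logq := logq) (lam := lam) (T := T) (t := t) ⟨i, by omega⟩ v
      simp only at h2
      rw [h2] at h1
      exact (kernel_factorOp hlogq hq hlam hT
        (hvB.apply_tailOp hT (show i + 1 + (N - (i + 1)) = N by omega)) h1).1 fun h => by
          simp [← h] at hi
  refine ⟨fun i => C c * z i, c, ?_, by simp only [hzb], fun i hi hiN => ?_⟩
  · rintro rfl
    simp [hcu] at hu0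
  · rw [hcu, tailOp_C_mul (show i + (N - i) = N by omega), hchain i (by omega) hi]
    simp only [map_mul]
    ring

end Factorization

/-! ### Wronskians of log-free functions. -/

section LogFree

variable {logq : ℂ}

theorem iterate_tau_logFree (a : ℂ) (f : ℂ[X]) (j : ℕ) :
    ∃ g, (tau logq)^[j] (xpow a * ofPoly f) = xpow a * ofPoly g := by
  induction j with
  | zero => exact ⟨f, rfl⟩
  | succ j ih =>
    obtain ⟨g, hg⟩ := ih
    refine ⟨C (qpow logq (-2 * a)) * dilate logq (-2) g, ?_⟩
    rw [Function.iterate_succ_apply', hg, map_mul, tau_xpow, tau_ofPoly, map_mul ofPoly]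
    ring

theorem xpow_sum {ι : Type*} (s : Finset ι) (a : ι → ℂ) :
    xpow (∑ i ∈ s, a i) = ∏ i ∈ s, xpow (a i) := by
  classical
  induction s using Finset.induction_on with
  | empty => simp [xpow_zero]
  | insert i s hi ih => rw [Finset.sum_insert hi, Finset.prod_insert hi, xpow_add, ih]

theorem wronskian_logFree {k : ℕ} {a : Fin k → ℂ} {g : Fin k → QuasiField}
    (h : ∀ i, IsLogFree (a i) (g i)) : IsLogFree (∑ i, a i) (wronskian logq g) := by
  choose f hf using h
  have h1 := fun (i : Fin k) (j : ℕ) => iterate_tau_logFree (logq := logq) (a i) (f i) j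
  choose w hw using h1
  refine ⟨(Matrix.of fun i j : Fin k => w i j).det, ?_⟩
  have h2 : (Matrix.of fun i j : Fin k => (tau logq)^[(j : ℕ)] (g i)) =
      Matrix.of fun i j : Fin k => xpow (a i) *
        (ofPoly.mapMatrix (Matrix.of fun i j : Fin k => w i j)) i j := by
    ext i j
    simp [hf, hw]
  rw [wronskian, h2, Matrix.det_mul_column, ← xpow_sum, RingHom.map_det]

end LogFree

theorem dvd_of_C_mul_eq_mul {c : ℂ} (hc : c ≠ 0) {f g h : ℂ[X]} (H : C c * f = g * h) : g ∣ f :=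
  (isUnit_C.2 hc.isUnit).dvd_mul_left.1 (H ▸ dvd_mul_right g h)

/-! ### Wronskians of the last functions and of arbitrary subfamilies. -/

section Tails

variable {N : ℕ} {logq : ℂ} {lam : Fin N → ℂ} {T : Fin (N - 1) → ℂ[X]} {l : Fin (N - 1) → ℕ}
  {t : Point l}

theorem tailWeight_self : tailWeight lam N = 0 := by
  rw [tailWeight, Finset.Icc_eq_empty (by omega), Finset.sum_empty]

theorem tailWeight_eq (i : Fin N) : tailWeight lam i = lam i + tailWeight lam (i + 1) := by
  rw [tailWeight, ← Finset.insert_Icc_succ_left_eq_Icc (by omega), Finset.sum_insert (by simp),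
    tailWeight]
  congr 1
  rw [entry, dif_pos ⟨by omega, by omega⟩]
  rfl

/-- The last `k` members of a sequence, where `i + k` is its length. -/
def lastTerms {R : Type*} (u : Fin N → R) {i k : ℕ} (h : i + k = N) : Fin k → R :=
  fun j => u ⟨i + j, by omega⟩

theorem lastTerms_succ {R : Type*} (u : Fin N → R) {i k : ℕ} (h : i + (k + 1) = N) :
    lastTerms u h = Fin.cons (u ⟨i, by omega⟩) (lastTerms u (show i + 1 + k = N by omega)) := by
  funext j
  refine Fin.cases rfl (fun j => ?_) j
  simp only [lastTerms, Fin.cons_succ, Fin.val_succ]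
  congr 2
  omega

variable {u : Fin N → QuasiField}
  (hlow : ∀ b : Fin N, ∀ i ≤ (b : ℕ), tailOp logq lam T t i (u b) = 0)
  (hchain : ∀ b : Fin N, ∃ (z : ℕ → ℂ[X]) (c : ℂ), c ≠ 0 ∧ z (b + 1) = C c * pPoly t b ∧
      ∀ i, (b : ℕ) + 1 ≤ i → i ≤ N → tailOp logq lam T t i (u b) =
        xpow (lam b) * ofPoly (z i * frameFactor logq T i) / ofPoly (pPoly t i))

include hlow in
theorem wronskian_cons_lastTerms {i k : ℕ} (h : i + k = N) (f : QuasiField) :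
    wronskian logq (Fin.cons f (lastTerms u h) : Fin (k + 1) → QuasiField) =
      (-1) ^ k * tailOp logq lam T t i f * wronskian logq (lastTerms u h) :=
  wronskian_cons_of_annihilated logq (isMonicDifferenceOp_tailOp h)
    (fun j => hlow _ i (Nat.le_add_right i j)) f

theorem neg_one_pow_eq_ofPoly (k : ℕ) : ((-1) ^ k : QuasiField) = ofPoly (C ((-1) ^ k)) := by
  simp

include hlow hchain in
-- Prepending `u_b`, with `b = i` counted from zero, multiplies the Wronskian by `± tailOp (i + 1)
-- (u_b)`, a multiple of `x^{λ_b} p_i F / p_{i+1}` with `F` the frame factor at `i + 1`. The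
-- denominator cancels the old `p_{i+1}`, and `F` extends the frame product.
theorem wronskian_lastTerms {i k : ℕ} (h : i + k = N) : ∃ c : ℂ, c ≠ 0 ∧
    wronskian logq (lastTerms u h) =
      xpow (tailWeight lam i) * ofPoly (C c * (pPoly t i * frameProd logq (withOne T) k)) := by
  induction k generalizing i with
  | zero =>
    obtain rfl : i = N := by omega
    refine ⟨1, one_ne_zero, ?_⟩
    rw [tailWeight_self, pPoly_eq_one t (by omega), frameProd_zero, xpow_zero]
    simp [wronskian]
  | succ k ih =>
    obtain ⟨c, hc, hW⟩ := ih (i := i + 1) (by omega)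
    obtain ⟨z, c', hc', hzb, hz⟩ := hchain ⟨i, by omega⟩
    refine ⟨(-1) ^ k * c' * c, mul_ne_zero (mul_ne_zero (by simp) hc') hc, ?_⟩
    have h1 := tailWeight_eq (lam := lam) ⟨i, by omega⟩
    simp only at h1 hzb
    rw [lastTerms_succ, wronskian_cons_lastTerms hlow, hW, hz (i + 1) le_rfl (by omega), hzb,
      frameProd_succ logq T (by omega), show N - k = i + 1 by omega, h1, xpow_add,
      neg_one_pow_eq_ofPoly]
    have e1 := mul_inv_cancel₀ (ofPoly_ne_zero (pPoly_ne_zero t (i + 1)))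
    simp only [map_mul]
    generalize xpow (lam ⟨i, _⟩) = a, ofPoly (C ((-1) ^ k)) = s
    linear_combination (s * a * ofPoly (C c') * ofPoly (pPoly t i) *
      ofPoly (frameFactor logq T (i + 1)) * xpow (tailWeight lam (i + 1)) * ofPoly (C c) *
      ofPoly (frameProd logq (withOne T) k)) * e1

include hlow hchain in
-- These are the Wronskians occurring in the Plücker relations: either `u_b` is repeated, or the
-- denominator `p_i` of its image cancels against the Wronskian of the last terms.
theorem dvd_wronskian_cons_lastTerms {i k : ℕ} (h : i + k = N) (hi : 1 ≤ i) (b : Fin N) :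
    ∃ y, wronskian logq (Fin.cons (u b) (lastTerms u h) : Fin (k + 1) → QuasiField) =
      xpow (lam b + tailWeight lam i) * ofPoly (frameProd logq (withOne T) (k + 1) * y) := by
  by_cases hb : i ≤ b
  · refine ⟨0, ?_⟩
    rw [wronskian_cons_lastTerms hlow, hlow b i hb]
    simp
  · obtain ⟨c, hc, hW⟩ := wronskian_lastTerms hlow hchain h
    obtain ⟨z, c', hc', hzb, hz⟩ := hchain b
    refine ⟨C ((-1) ^ k) * C c * z i, ?_⟩
    rw [wronskian_cons_lastTerms hlow, hW, hz i (by omega) (by omega),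
      frameProd_succ logq T (by omega), show N - k = i by omega, xpow_add,
      neg_one_pow_eq_ofPoly]
    have e1 := ofPoly_ne_zero (pPoly_ne_zero t i)
    simp only [map_mul]
    field_simp

include hlow hchain in
-- In both Plücker relations each summand is divisible by `Q_k` (or its dilation), by induction,
-- times `Q_{k+1}`, while the Wronskian of the last `k` functions contributes `Q_k` (dilated alike)
-- and `p_{N-k}` or `p_{N-k}(xq⁻²)` on the other side. Cancel `Q_k` and use coprimality.
theorem dvd_wronskian (hT : ∀ i, (T i).Monic) (hadm : IsAdmissible logq t) {k : ℕ} (hk : k ≤ N)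
    (e : Fin k → Fin N) : ∃ y, wronskian logq (fun j => u (e j)) =
      xpow (∑ j, lam (e j)) * ofPoly (frameProd logq (withOne T) k * y) := by
  induction k with
  | zero => exact ⟨1, by simp [wronskian, frameProd_zero, xpow_zero]⟩
  | succ k ih =>
    have hik : N - k + k = N := by omega
    obtain ⟨c, hc, hW⟩ := wronskian_lastTerms hlow hchain hik
    have hfree : ∀ b, IsLogFree (lam b) (u b) := by
      intro b
      obtain ⟨z, _, _, _, hz⟩ := hchain b
      refine ⟨z N, ?_⟩
      have := hz N (by omega) le_rfl
      rwa [tailOp_self, frameFactor_of_le logq T (by omega) le_rfl, pPoly_eq_one t (by omega),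
        map_one, div_one, mul_one] at this
    obtain ⟨w, hw⟩ := wronskian_logFree (logq := logq) fun j => hfree (e j)
    have hext := dvd_wronskian_cons_lastTerms hlow hchain hik (by omega)
    choose y hy using hext
    have hmin := fun b : Fin (k + 1) => ih (by omega) fun j => e (b.succAbove j)
    choose v hv using hmin
    obtain ⟨s, hs⟩ : ∃ s : Fin (k + 1) → ℂ, ∀ b, ∑ j, lam (e (b.succAbove j)) = s b :=
      ⟨_, fun _ => rfl⟩
    -- All summands carry the same total power of `x`, so it can be cancelled.
    have hsum : ∀ b : Fin (k + 1), ∑ j, lam (e j) = lam (e b) + s b := fun b => by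
      rw [← hs]
      exact Fin.sum_univ_succAbove _ b
    simp only [hs] at hv
    have hQ := frameProd_ne_zero (N := N) logq hT k
    have h1 : frameProd logq (withOne T) (k + 1) ∣ pPoly t (N - k) * w := by
      have h := wronskian_mul_wronskian logq (lastTerms u hik) (fun j => u (e j))
      rw [hW, hw] at h
      have h2 : frameProd logq (withOne T) k * (C c * (pPoly t (N - k) * w)) =
          frameProd logq (withOne T) k * (frameProd logq (withOne T) (k + 1) *
            ∑ b : Fin (k + 1), C ((-1) ^ (b : ℕ)) * v b * y (e b)) := by
        apply ofPoly_injective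
        apply mul_left_cancel₀ (mul_ne_zero (xpow_ne_zero (tailWeight lam (N - k)))
          (xpow_ne_zero (∑ j, lam (e j))))
        calc _ = _ := ?_
          _ = _ := h
          _ = _ := ?_
        · simp only [map_mul]
          ring
        · simp only [map_mul, map_sum, Finset.mul_sum]
          refine Finset.sum_congr rfl fun b _ => ?_
          rw [hv, hy, hsum b, xpow_add, xpow_add, neg_one_pow_eq_ofPoly]
          simp only [map_mul]
          ring
      have h3 := mul_left_cancel₀ hQ h2
      exact (dvd_of_C_mul_eq_mul hc h3)
    have h1' : frameProd logq (withOne T) (k + 1) ∣ dilate logq (-2) (pPoly t (N - k)) * w := by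
      have h := tau_wronskian_mul_wronskian logq (lastTerms u hik) (fun j => u (e j))
      rw [hW, hw] at h
      have h2 : dilate logq (-2) (frameProd logq (withOne T) k) *
          (C (qpow logq (-2 * tailWeight lam (N - k)) * c) *
            (dilate logq (-2) (pPoly t (N - k)) * w)) =
          dilate logq (-2) (frameProd logq (withOne T) k) *
            (frameProd logq (withOne T) (k + 1) * ∑ b : Fin (k + 1), C ((-1) ^ (b : ℕ)) *
              C (qpow logq (-2 * s b)) *
                dilate logq (-2) (v b) * y (e b)) := by
        apply ofPoly_injective
        apply mul_left_cancel₀ (mul_ne_zero (xpow_ne_zero (tailWeight lam (N - k)))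
          (xpow_ne_zero (∑ j, lam (e j))))
        calc _ = _ := ?_
          _ = _ := h
          _ = _ := ?_
        · simp only [map_mul, tau_xpow, tau_ofPoly, dilate_C]
          ring
        · simp only [map_mul, map_sum, Finset.mul_sum]
          refine Finset.sum_congr rfl fun b _ => ?_
          rw [hv, hy, hsum b, xpow_add, xpow_add, neg_one_pow_eq_ofPoly]
          simp only [map_mul, tau_xpow, tau_ofPoly]
          ring
      have h3 := mul_left_cancel₀ (dilate_ne_zero logq hQ) h2
      exact (dvd_of_C_mul_eq_mul (mul_ne_zero (qpow_ne_zero _ _) hc) h3)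
    obtain ⟨a, b, hab⟩ := isCoprime_dilate logq (a := -2) (isCoprime_pPoly hadm (N - k))
    rw [dilate_dilate, neg_add_cancel, dilate_zero] at hab
    have hdvd : frameProd logq (withOne T) (k + 1) ∣ w := by
      have : w = b * (pPoly t (N - k) * w) + a * (dilate logq (-2) (pPoly t (N - k)) * w) := by
        linear_combination (-w) * hab
      rw [this]
      exact dvd_add (h1.mul_left _) (h1'.mul_left _)
    obtain ⟨y', rfl⟩ := hdvd
    exact ⟨y', hw⟩

end Tails
end XXZ

end
open XXZ in
theorem theorem5p11 (N : ℕ) (hN : 2 ≤ N)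
    (q logq : ℂ) (hlogq : Complex.exp logq = q)
    (hq : ∀ n : ℕ, 0 < n → q ^ n ≠ 1)
    (lam : Fin N → ℂ) (hlam : IsGenericWeight logq lam)
    (l : Fin (N - 1) → ℕ)
    (T : Fin (N - 1) → Polynomial ℂ) (hT : ∀ i, (T i).Monic)
    (t : Point l) (ht : IsRegularSolution logq lam T t) (hadm : IsAdmissible logq t)
    (U : Collection logq lam)
    (hU : (pointOp logq lam T t : QuasiField → QuasiField) = U.fundamentalOp) :
    IsPreframe U (withOne T) ∧ U.IsRegular (withOne T) ∧
      orbit t = rootOrbit U (withOne T) := by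
  have hlogq0 : logq ≠ 0 := by
    rintro rfl
    exact hq 1 one_pos (by rw [pow_one, ← hlogq, Complex.exp_zero])
  -- As `q` is not a root of unity, the powers of `q⁻²` are distinct.
  have hqinj : Function.Injective fun n : ℕ => qpow logq (-2) ^ n := by
    have h1 : qpow logq (-2) = (q ^ 2)⁻¹ := by
      rw [qpow, ← hlogq, ← Complex.exp_nat_mul, ← Complex.exp_neg]
      norm_num
    have hq0 : q ≠ 0 := hlogq ▸ Complex.exp_ne_zero _
    have key : ∀ m n : ℕ, m < n → (q ^ 2) ^ m ≠ (q ^ 2) ^ n := by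
      intro m n hmn h
      obtain ⟨d, rfl⟩ := Nat.exists_eq_add_of_lt hmn
      rw [add_assoc, pow_add, left_eq_mul₀ (pow_ne_zero _ (pow_ne_zero _ hq0)), ← pow_mul] at h
      exact hq _ (by omega) h
    intro m n h
    simp only [h1, inv_pow, inv_inj] at h
    rcases lt_trichotomy m n with hlt | heq | hlt
    · exact absurd h (key m n hlt)
    · exact heq
    · exact absurd h.symm (key n m hlt)
  have hu0 : ∀ b, U.u b ≠ 0 := by
    intro b hb
    apply U.wronskian_ne_zero
    refine Matrix.det_eq_zero_of_row_eq_zero b fun j => ?_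
    rw [Matrix.of_apply, hb]
    exact Function.iterate_fixed (map_zero _) _
  have hmain := fun b => exists_tailOp_apply_eq hlogq0 hqinj hlam hT ht hadm b
    (U.isQuasiPoly b) (hu0 b) (by rw [hU, U.fundamentalOp_apply])
  have hlow := fun b => (hmain b).1
  have hchain := fun b => (hmain b).2
  have htail : ∀ i ≤ N, ∃ c : ℂ, c ≠ 0 ∧ tailWronskian logq U.u i =
      xpow (tailWeight lam i) *
        ofPoly (C c * (pPoly t i * frameProd logq (withOne T) (N - i))) := fun i hi =>
    wronskian_lastTerms hlow hchain (show i + (N - i) = N by omega)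
  have hy : ∀ i ≤ N, ∃ c : ℂ, c ≠ 0 ∧ U.y (withOne T) i =
      xpow (tailWeight lam i) * ofPoly (C c * pPoly t i) := by
    intro i hi
    obtain ⟨c, hc, h⟩ := htail i hi
    refine ⟨c, hc, ?_⟩
    have := ofPoly_ne_zero (frameProd_ne_zero (N := N) logq hT (N - i))
    rw [Collection.y, h, ← mul_assoc (C c), map_mul ofPoly (C c * _)]
    field_simp
  have hsum : tailWeight lam 0 = ∑ i, lam i := by
    rw [tailWeight, zero_add, ← Finset.Ico_add_one_right_eq_Icc, Finset.sum_Ico_eq_sum_range,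
      Nat.add_sub_cancel, Finset.sum_range]
    refine Finset.sum_congr rfl fun i _ => ?_
    rw [entry, dif_pos ⟨by omega, by omega⟩]
    simp
  have hW : ∃ c : ℂ, wronskian logq U.u =
      xpow (∑ i, lam i) * ofPoly (C c * frameProd logq (withOne T) N) := by
    -- The full Wronskian is the tail at `i = 0`, where `p_0 = 1`.
    obtain ⟨c, -, h⟩ := wronskian_lastTerms hlow hchain (zero_add N)
    refine ⟨c, ?_⟩
    rw [hsum, pPoly_eq_one t (by omega), one_mul] at h
    rw [← h]
    congr 1
    funext j
    simp [lastTerms]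
  have hsemi : U.IsSemiregular := by
    obtain ⟨c, h⟩ := hW
    exact ⟨_, h⟩
  have hroot : IsRootPoint U (withOne T) t := by
    intro i
    obtain ⟨c, hc, h⟩ := hy (i + 1) (by omega)
    refine ⟨c, hc, ?_⟩
    rw [h, pPoly_succ]
  refine ⟨⟨hsemi, fun i => ?_, fun k _ hk e => ?_, hW⟩, ⟨hsemi, fun i _ hi => ?_⟩,
    (rootOrbit_eq hroot).symm⟩
  · exact entry_one_monic hT _
  · obtain ⟨y, h⟩ := dvd_wronskian hlow hchain hT hadm (show k ≤ N by omega) e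
    exact ⟨C (frameProd logq (withOne T) k * y), h, by rw [C_mul]; exact dvd_mul_right _ _⟩
  · obtain ⟨c, _, h⟩ := hy i (by omega)
    exact ⟨_, h⟩
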